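/- Let $L\ge 1$, $0<q<1$, and $0<\mu_1,\dots,\mu_L<1$. Write $(z)_m=\prod_{j=1}^m(1-zq^{j-1})$, $\binom{m}{k}_q=\frac{(q)_m}{(q)_k(q)_{m-k}}$ for $0\le k\le m$ and $0$ otherwise, and, for $\alpha,\beta\in\mathbb Z_{\ge0}^2$, $|\alpha|=\alpha_1+\alpha_2$, $\varphi(\alpha,\beta)=\alpha_1\beta_2$. Put $$\Phi_q(\gamma|\beta;\lambda,\mu)=q^{\varphi(\beta-\gamma,\gamma)}\Big(\frac{\mu}{\lambda}\Big)^{|\gamma|}\frac{(\lambda)_{|\gamma|}(\mu/\lambda)_{|\beta|-|\gamma|}}{(\mu)_{|\beta|}}\prod_{i=1}^2\binom{\beta_i}{\gamma_i}_q$$ (so that $\Phi_q=0$ unless $\gamma\le\beta$), and let $\mathscr S(\lambda,\mu)^{\gamma,\delta}_{\alpha,\beta}=\Phi_q(\gamma|\beta;\lambda,\mu)$ if $\gamma+\delta=\alpha+\beta$ and $0$ otherwise. The Markov transfer matrix $T=T(\lambda|\mu_1,\dots,\mu_L)$ of the inhomogeneous discrete-time $U_q(A^{(1)}_2)$ zero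 range process on $L$ sites acts on $\bigoplus_{\sigma\in(\mathbb Z_{\ge0}^2)^L}\mathbb C|\sigma\rangle$ by $T|\beta_1,\dots,\beta_L\rangle=\sum_\alpha T^{\alpha_1,\dots,\alpha_L}_{\beta_1,\dots,\beta_L}|\alpha_1,\dots,\alpha_L\rangle$ with $$T^{\alpha_1,\dots,\alpha_L}_{\beta_1,\dots,\beta_L}=\sum_{\gamma_1,\dots,\gamma_L\in\mathbb Z_{\ge0}^2}\ \prod_{i=1}^L\mathscr S(\lambda,\mu_i)^{\gamma_i,\alpha_i}_{\gamma_{i-1},\beta_i},\qquad \gamma_0=\gamma_L .$$ For $m=(m_1,m_2)$ let $S(m)=\{(\sigma_1,\dots,\sigma_L)\in(\mathbb Z_{\ge0}^2)^L:\sigma_1+\cdots+\sigma_L=m\}$. On the Fock space with basis $|n\rangle$, $n\ge0$ (completed to formal infinite sums), let $\mathbf b_+|n\rangle=|n+1\rangle$, $\mathbf b_-|n\rangle=(1-q^n)|n-1\rangle$, $\mathbf k|n\rangle=q^n|n\rangle$ (with $|-1\rangle=0$), let $\langle n|n'\rangle=\delta_{n,n'}(q)_n$ and $\mathrm{Tr}(X)=\sum_{n\ge0}\langle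 n|X|n\rangle/(q)_n$. For $\alpha=(\alpha_1,\alpha_2)\in\mathbb Z_{\ge0}^2$ put $$g_\alpha(\mu)=\frac{\mu^{-|\alpha|}(\mu)_{|\alpha|}}{(q)_{\alpha_1}(q)_{\alpha_2}},\qquad Z_\alpha(\mu)=\frac{(\mathbf b_+)_\infty}{(\mu^{-1}\mathbf b_+)_\infty}\,\mathbf k^{\alpha_2}\mathbf b_-^{\alpha_1},\qquad \frac{(\mathbf b_+)_\infty}{(\mu^{-1}\mathbf b_+)_\infty}:=\sum_{j\ge0}\frac{(\mu)_j}{(q)_j}\mu^{-j}\mathbf b_+^j .$$ Let $m=(m_1,m_2)$ with $m_1,m_2\ge1$. Then for every $(\sigma_1,\dots,\sigma_L)\in S(m)$ the trace $\mathrm{Tr}(Z_{\sigma_1}(\mu_1)\cdots Z_{\sigma_L}(\mu_L))$ converges absolutely, and $$\mathbb P(\sigma_1,\dots,\sigma_L)=\Big(\prod_{i=1}^L g_{\sigma_i}(\mu_i)\Big)\mathrm{Tr}\big(Z_{\sigma_1}(\mu_1)\cdots Z_{\sigma_L}(\mu_L)\big)$$ is positive. Moreover these numbers are the unnormalized steady-state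 probabilities of the process in the sector $m$: for every $\lambda$ with $\max_i\mu_i<\lambda<1$, the vector $|\overline P(m)\rangle=\sum_{\sigma\in S(m)}\mathbb P(\sigma)|\sigma\rangle$ satisfies $T(\lambda|\mu_1,\dots,\mu_L)|\overline P(m)\rangle=|\overline P(m)\rangle$, and every vector of $\bigoplus_{\sigma\in S(m)}\mathbb C|\sigma\rangle$ fixed by $T(\lambda|\mu_1,\dots,\mu_L)$ is a scalar multiple of it. -/

import Mathlib

noncomputable section

namespace ZRP

/-! Finite `q`-calculus -/

/-- The `q`-Pochhammer symbol `(z)_m = (z; q)_m = ∏_{j=1}^m (1 - z q^(j-1))`. -/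
def qPoch (q z : ℝ) (m : ℕ) : ℝ := ∏ j ∈ Finset.range m, (1 - z * q ^ j)

/-- The `q`-binomial `(q)_m / ((q)_k (q)_(m-k))` for `0 ≤ k ≤ m`, and `0` for `k > m`. -/
def qBinom (q : ℝ) (m k : ℕ) : ℝ :=
  if k ≤ m then qPoch q q m / (qPoch q q k * qPoch q q (m - k)) else 0

/-! Local states, the stochastic `R` matrix -/

/-- A local state of `n` species: `α i` is the number of particles of species `i`. -/
abbrev Local (n : ℕ) : Type := Fin n → ℕ

/-- `|α| = α_1 + ⋯ + α_n`. -/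
def size {n : ℕ} (α : Local n) : ℕ := ∑ i, α i

/-- `φ(α, β) = ∑_{i < j} α_i β_j`. -/
def phi {n : ℕ} (α β : Local n) : ℕ := ∑ i, ∑ j ∈ Finset.Ioi i, α i * β j

/-- `Φ_q(γ | β; lam, mu)`. It vanishes unless `γ ≤ β` because of the `q`-binomials, so that the
subtractions of natural numbers are only relevant when they are exact. -/
def Phi (q : ℝ) {n : ℕ} (γ β : Local n) (lam mu : ℝ) : ℝ :=
  q ^ phi (β - γ) γ * (mu / lam) ^ size γ *
    (qPoch q lam (size γ) * qPoch q (mu / lam) (size β - size γ) / qPoch q mu (size β)) *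
    ∏ i, qBinom q (β i) (γ i)

/-- The element `S(lam, mu)^{γ, δ}_{α, β}` of the stochastic `R` matrix: `α, β` label the
incoming (horizontal, vertical) edges and `γ, δ` the outgoing (horizontal, vertical) ones. -/
def stochR (q : ℝ) {n : ℕ} (lam mu : ℝ) (α β γ δ : Local n) : ℝ :=
  if γ + δ = α + β then Phi q γ β lam mu else 0

/-- `g_α(mu) = mu^(-|α|) (mu)_{|α|} / ∏_i (q)_{α_i}`. -/
def gWeight (q : ℝ) {n : ℕ} (mu : ℝ) (α : Local n) : ℝ :=
  mu⁻¹ ^ size α * qPoch q mu (size α) / ∏ i, qPoch q q (α i)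

/-! The Markov transfer matrix on the periodic chain with `L` sites -/

/-- Configurations on the ring with sites `Fin L` (cyclic: `i - 1` is the left neighbour). -/
abbrev Config (L n : ℕ) : Type := Fin L → Local n

/-- The matrix element `T(lam | mu_1, …, mu_L)^{α_1, …, α_L}_{β_1, …, β_L}` (from `β` to `α`):
the trace over the auxiliary space of the product of the `R` matrices, i.e. the sum over all
horizontal edge variables `γ_i`, where `γ_i` joins site `i` to site `i + 1` cyclically. Only
finitely many terms are nonzero, see `transferEntry_support_finite`. -/
def transferEntry (q : ℝ) {L n : ℕ} [NeZero L] (lam : ℝ) (mu : Fin L → ℝ)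
    (α β : Config L n) : ℝ :=
  ∑ᶠ γ : Config L n, ∏ i, stochR q lam (mu i) (γ (i - 1)) (β i) (γ i) (α i)

theorem Phi_eq_zero (q : ℝ) {n : ℕ} (γ β : Local n) (lam mu : ℝ) (h : ¬ γ ≤ β) :
    Phi q γ β lam mu = 0 := by
  rw [Pi.le_def] at h
  push Not at h
  obtain ⟨i, hi⟩ := h
  have : ∏ i, qBinom q (β i) (γ i) = 0 :=
    Finset.prod_eq_zero (Finset.mem_univ i) (by simp [qBinom, hi])
  simp [Phi, this]

theorem transferEntry_term_ne_zero (q : ℝ) {L n : ℕ} [NeZero L] (lam : ℝ) (mu : Fin L → ℝ)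
    (α β γ : Config L n)
    (h : ∏ i, stochR q lam (mu i) (γ (i - 1)) (β i) (γ i) (α i) ≠ 0) (i : Fin L) :
    γ i ≤ β i ∧ γ i + α i = γ (i - 1) + β i := by
  have hi := Finset.prod_ne_zero_iff.mp h i (Finset.mem_univ i)
  by_cases hc : γ i + α i = γ (i - 1) + β i
  · refine ⟨?_, hc⟩
    by_contra hle
    exact hi (by simp [stochR, Phi_eq_zero q _ _ lam (mu i) hle])
  · exact absurd (by simp [stochR, hc]) hi

theorem transferEntry_support_finite (q : ℝ) {L n : ℕ} [NeZero L] (lam : ℝ) (mu : Fin L → ℝ)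
    (α β : Config L n) :
    (Function.support fun γ : Config L n =>
      ∏ i, stochR q lam (mu i) (γ (i - 1)) (β i) (γ i) (α i)).Finite :=
  (Set.finite_Iic β).subset fun γ h i => (transferEntry_term_ne_zero q lam mu α β γ h i).1

theorem transferEntry_column_finite (q : ℝ) {L n : ℕ} [NeZero L] (lam : ℝ) (mu : Fin L → ℝ)
    (β : Config L n) :
    (Function.support fun α : Config L n => ((transferEntry q lam mu α β : ℝ) : ℂ)).Finite := by
  refine (Set.finite_Iic (fun i => β (i - 1) + β i)).subset fun α h i => ?_
  have h0 : transferEntry q lam mu α β ≠ 0 := by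
    intro h0
    exact h (by simp [h0])
  obtain ⟨γ, hγ⟩ : ∃ γ : Config L n,
      ∏ i, stochR q lam (mu i) (γ (i - 1)) (β i) (γ i) (α i) ≠ 0 := by
    by_contra hno
    push Not at hno
    exact h0 (by simp [transferEntry, hno])
  have h1 := transferEntry_term_ne_zero q lam mu α β γ hγ
  calc α i ≤ γ i + α i := le_add_self
    _ = γ (i - 1) + β i := (h1 i).2
    _ ≤ β (i - 1) + β i := add_le_add_left (h1 (i - 1)).1 _

/-- The state space `W^{⊗ L}`, with basis the vectors `|σ_1, …, σ_L⟩`. -/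
abbrev StateSpace (L n : ℕ) : Type := Config L n →₀ ℂ

/-- The Markov transfer matrix `T(lam | mu_1, …, mu_L)` as an operator on `W^{⊗ L}`:
`T |β⟩ = ∑_α T^α_β |α⟩`. -/
def transfer (q : ℝ) {L n : ℕ} [NeZero L] (lam : ℝ) (mu : Fin L → ℝ) :
    StateSpace L n →ₗ[ℂ] StateSpace L n :=
  Finsupp.linearCombination ℂ fun β : Config L n =>
    Finsupp.ofSupportFinite (fun α => ((transferEntry q lam mu α β : ℝ) : ℂ))
      (transferEntry_column_finite q lam mu β)

/-- `S(m)`: the configurations with `m_a` particles of species `a` in total. -/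
def sector (L : ℕ) {n : ℕ} (m : Local n) : Set (Config L n) := {σ | ∑ i, σ i = m}

theorem sector_finite (L : ℕ) {n : ℕ} (m : Local n) : (sector L m).Finite := by
  refine (Set.finite_Iic (fun _ => m)).subset fun σ h i => ?_
  rw [← (show ∑ i, σ i = m from h)]
  exact Finset.single_le_sum (f := σ) (fun _ _ => zero_le) (Finset.mem_univ i)

/-- The sector `⊕_{σ ∈ S(m)} ℂ |σ⟩` of the state space. -/
def sectorSpace (L : ℕ) {n : ℕ} (m : Local n) : Submodule ℂ (StateSpace L n) :=
  Finsupp.supported ℂ ℂ (sector L m)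

/-! The `q`-boson Fock space -/

/-- The completed Fock space `∏_{m ≥ 0} ℝ |m⟩`: the family `v` is the formal sum
`∑_m v m |m⟩`. Power series in `b₊` act on it. All matrix elements below are real. -/
abbrev Fock : Type := ℕ → ℝ

/-- The basis vector `|m⟩`. -/
def ket (m : ℕ) : Fock := Pi.single m 1

/-- `b₊ |m⟩ = |m + 1⟩`. -/
def bPlus : Module.End ℝ Fock where
  toFun v := fun m => if m = 0 then 0 else v (m - 1)
  map_add' v w := by ext m; by_cases h : m = 0 <;> simp [h]
  map_smul' c v := by ext m; by_cases h : m = 0 <;> simp [h]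

/-- `b₋ |m⟩ = (1 - q^m) |m - 1⟩`. -/
def bMinus (q : ℝ) : Module.End ℝ Fock where
  toFun v := fun m => (1 - q ^ (m + 1)) * v (m + 1)
  map_add' v w := by ext m; simp [mul_add]
  map_smul' c v := by ext m; simp [mul_left_comm]

/-- `k |m⟩ = q^m |m⟩`. -/
def kOp (q : ℝ) : Module.End ℝ Fock where
  toFun v := fun m => q ^ m * v m
  map_add' v w := by ext m; simp [mul_add]
  map_smul' c v := by ext m; simp [mul_left_comm]

theorem bPlus_ket (m : ℕ) : bPlus (ket m) = ket (m + 1) := by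
  ext (_ | n) <;> simp [bPlus, ket, Pi.single_apply]

theorem bMinus_ket_zero (q : ℝ) : bMinus q (ket 0) = 0 := by
  ext n; simp [bMinus, ket]

theorem bMinus_ket_succ (q : ℝ) (m : ℕ) :
    bMinus q (ket (m + 1)) = (1 - q ^ (m + 1)) • ket m := by
  ext n
  by_cases h : n = m <;> simp [bMinus, ket, h]

theorem kOp_ket (q : ℝ) (m : ℕ) : kOp q (ket m) = q ^ m • ket m := by
  ext n
  by_cases h : n = m <;> simp [kOp, ket, h]

/-- The operator `∑_{j ≥ 0} c_j b₊^j`. The coefficient of `|m⟩` in `b₊^j v` vanishes for `j > m`,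
so only the terms with `j ≤ m` enter, see `bPlusSeries_hasSum`. -/
def bPlusSeries (c : ℕ → ℝ) : Module.End ℝ Fock where
  toFun v := fun m => ∑ j ∈ Finset.range (m + 1), c j * (bPlus ^ j) v m
  map_add' v w := by ext m; simp [mul_add, Finset.sum_add_distrib]
  map_smul' a v := by ext m; simp [Finset.mul_sum, mul_left_comm]

theorem bPlus_pow_apply_eq_zero (v : Fock) (j m : ℕ) (h : m < j) : (bPlus ^ j) v m = 0 := by
  induction j generalizing m with
  | zero => omega
  | succ j ih =>
    rw [pow_succ']
    by_cases hm : m = 0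
    · simp [bPlus, hm]
    · simpa [bPlus, hm] using ih (m - 1) (by omega)

/-- `bPlusSeries c` is the sum of the series `∑_j c_j b₊^j`, coefficient by coefficient. -/
theorem bPlusSeries_hasSum (c : ℕ → ℝ) (v : Fock) :
    HasSum (fun j => c j • (bPlus ^ j) v) (bPlusSeries c v) := by
  refine Pi.hasSum.mpr fun m => ?_
  refine hasSum_sum_of_ne_finset_zero (s := Finset.range (m + 1)) fun j hj => ?_
  have : m < j := by simpa [Nat.lt_succ_iff] using hj
  simp [bPlus_pow_apply_eq_zero v j m this]

/-- The ratio of infinite products `(b₊)_∞ / (mu⁻¹ b₊)_∞`, defined by the series expansion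
`(z w)_∞ / (z)_∞ = ∑_j (w)_j / (q)_j z^j` with `w = mu` and `z = mu⁻¹ b₊`. -/
def dilogOp (q mu : ℝ) : Module.End ℝ Fock :=
  bPlusSeries fun j => qPoch q mu j / qPoch q q j * mu⁻¹ ^ j

/-- `Z_α(mu) = (b₊)_∞ / (mu⁻¹ b₊)_∞ · k^{α_2} b₋^{α_1}`. -/
def zOp (q mu : ℝ) (α : Local 2) : Module.End ℝ Fock :=
  dilogOp q mu * kOp q ^ α 1 * bMinus q ^ α 0

/-- The product `Z_{σ_1}(mu_1) ⋯ Z_{σ_L}(mu_L)`, in this order. -/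
def zProd (q : ℝ) {L : ℕ} (mu : Fin L → ℝ) (σ : Config L 2) : Module.End ℝ Fock :=
  (List.ofFn fun i => zOp q (mu i) (σ i)).prod

/-- The linear form `⟨m|`, normalized by `⟨m | m'⟩ = (q)_m` if `m = m'`, and `0` otherwise. -/
def bra (q : ℝ) (m : ℕ) : Fock →ₗ[ℝ] ℝ := qPoch q q m • LinearMap.proj m

/-- The `m`-th term `⟨m| X |m⟩ / (q)_m` of the trace. -/
def traceTerm (q : ℝ) (X : Module.End ℝ Fock) (m : ℕ) : ℝ := bra q m (X (ket m)) / qPoch q q m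

/-- The trace over the Fock space, `Tr X = ∑_{m ≥ 0} ⟨m| X |m⟩ / (q)_m`. It is meaningful when the
series converges. -/
def fockTrace (q : ℝ) (X : Module.End ℝ Fock) : ℝ := ∑' m, traceTerm q X m

/-- The matrix product expression
`ℙ(σ_1, …, σ_L) = (∏_i g_{σ_i}(mu_i)) Tr (Z_{σ_1}(mu_1) ⋯ Z_{σ_L}(mu_L))`. -/
def matrixProduct (q : ℝ) {L : ℕ} (mu : Fin L → ℝ) (σ : Config L 2) : ℝ :=
  (∏ i, gWeight q (mu i) (σ i)) * fockTrace q (zProd q mu σ)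

/-- The vector `∑_{σ ∈ S(m)} ℙ(σ) |σ⟩` in the sector `m`. -/
def matrixProductState (q : ℝ) {L : ℕ} (mu : Fin L → ℝ) (m : Local 2) : StateSpace L 2 :=
  ∑ σ ∈ (sector_finite L m).toFinset, Finsupp.single σ ((matrixProduct q mu σ : ℝ) : ℂ)

end ZRP

end

/-! ### Finite `q`-calculus. -/

noncomputable section
namespace ZRP
open Finset

/-! Write `D(μ) = (b₊)_∞ / (μ⁻¹ b₊)_∞` and `e_α = k^{α₂} b₋^{α₁}`, so that `Z_α(μ) = D(μ) e_α`.
Stationarity rests on the exchange relation `dilogOp_exchange`, `D(λ) ∑_{γ ≤ α} g_γ(λ) h_{α-γ} e_γ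
D(μ) e_{α-γ} = g_α(μ) Z_α(μ) D(λ)`, with `h` the weight `hWeight`. Multiplied over the sites, it
shows that conjugation by the invertible `D(λ)`, invisible under the trace, turns `ℙ(α)` into a sum
over `ε ≤ α` of weighted traces of `∏ e_{ε_i} D(μ_i) e_{α_i-ε_i}` (`sum_weight_mul_fockTrace`).
Rotating the factor `e_{ε_0}` to the end regroups this as `∏ D(μ_i) e_{α_i-ε_i} e_{ε_{i+1}}`, a
power of `q` times `∏ Z_{β_i}(μ_i)` with `β_i = ε_{i+1} + α_i - ε_i`. By `gWeight_mul_Phi` the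
weights are those of `ℙ(β)` times the `R` matrix entries, and `ε` is the tuple of horizontal edges:
the sum is the `α` coordinate of `T` applied to the state.

The exchange relation comes from a generating function. The coefficients of `(k + b₋ x)^n` are the
`e_α` with `|α| = n`, up to `q`-binomials. For a suitable pair `P`, `Q` with `P Q = q Q P` one has
`k + b₋ x = P + Q` and `(k + b₋ x) D(μ) = D(μ) (P + μ⁻¹ Q)`. The relation then becomes
`sum_pencil_pow`, an identity between powers of elements `P + r Q`.

Traces converge and are cyclic because a particle of species 2 contributes a factor `k`, hence
geometric decay near the diagonal. Positivity is read off from matrix elements. Uniqueness is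
Perron–Frobenius: every single-particle hop to the next site has positive probability, and such hops
connect the sector. -/

theorem qPoch_succ (q z : ℝ) (n : ℕ) : qPoch q z (n + 1) = qPoch q z n * (1 - z * q ^ n) :=
  prod_range_succ _ _

theorem qPoch_self_succ (q : ℝ) (n : ℕ) :
    qPoch q q (n + 1) = qPoch q q n * (1 - q ^ (n + 1)) := by
  rw [qPoch_succ, pow_succ']

theorem qPoch_pos {q z : ℝ} (hq0 : 0 < q) (hq1 : q < 1) (hz0 : 0 ≤ z) (hz1 : z < 1) (n : ℕ) :
    0 < qPoch q z n := by
  refine prod_pos fun j _ => ?_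
  have h1 : q ^ j ≤ 1 := pow_le_one₀ hq0.le hq1.le
  nlinarith

/-- The divided shifted power `∏_{j < n} (x - y q^j) / (q)_n`. -/
def qDivPow (q x y : ℝ) (n : ℕ) : ℝ := (∏ j ∈ range n, (x - y * q ^ j)) / qPoch q q n

theorem qDivPow_zero (q x y : ℝ) : qDivPow q x y 0 = 1 := by simp [qDivPow, qPoch]

theorem qDivPow_succ {q : ℝ} (hq : ∀ n, qPoch q q n ≠ 0) (x y : ℝ) (n : ℕ) :
    (1 - q ^ (n + 1)) * qDivPow q x y (n + 1) = qDivPow q x y n * (x - y * q ^ n) := by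
  have h := hq (n + 1)
  rw [qPoch_self_succ] at h
  have h1 := left_ne_zero_of_mul h
  have h2 := right_ne_zero_of_mul h
  rw [qDivPow, qDivPow, prod_range_succ, qPoch_self_succ]
  field_simp

/-- Peels off the first factor instead of the last; the remaining product has `y` shifted to `y q`.
-/
theorem qDivPow_succ' {q : ℝ} (hq : ∀ n, qPoch q q n ≠ 0) (x y : ℝ) (n : ℕ) :
    (1 - q ^ (n + 1)) * qDivPow q x y (n + 1) = (x - y) * qDivPow q x (y * q) n := by
  have h := hq (n + 1)
  rw [qPoch_self_succ] at h
  have h1 := left_ne_zero_of_mul h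
  have h2 := right_ne_zero_of_mul h
  rw [qDivPow, qDivPow, prod_range_succ', qPoch_self_succ]
  simp only [pow_zero, mul_one]
  rw [prod_congr rfl fun j _ => show x - y * q ^ (j + 1) = x - y * q * q ^ j by ring]
  generalize ∏ j ∈ range n, (x - y * q * q ^ j) = t
  field_simp

theorem qDivPow_inv {q z : ℝ} (hz : z ≠ 0) (n : ℕ) :
    qDivPow q z⁻¹ 1 n = z⁻¹ ^ n * qPoch q z n / qPoch q q n := by
  rw [qDivPow, pow_eq_prod_const, qPoch, qPoch, ← prod_mul_distrib]
  congr 1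
  refine prod_congr rfl fun j _ => ?_
  field_simp

/-- With `qDivPow_inv`, this makes the weights `gWeight` and `hWeight` instances of one divided
power, at the pairs `(z⁻¹, 1)` and `(z⁻¹, w⁻¹)`. -/
theorem qDivPow_inv_inv {q z w : ℝ} (hz : z ≠ 0) (n : ℕ) :
    qDivPow q z⁻¹ w⁻¹ n = z⁻¹ ^ n * qPoch q (z / w) n / qPoch q q n := by
  rw [qDivPow, pow_eq_prod_const, qPoch, qPoch, ← prod_mul_distrib]
  congr 1
  refine prod_congr rfl fun j _ => ?_
  field_simp

/-! ### Powers of a pencil of `q`-commuting elements. -/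

section Algebra

variable {A : Type*} [Ring A] [Algebra ℝ A]

/-- The `q`-binomial theorem for `q`-commuting elements of an algebra. -/
theorem add_pow_of_qCommute {q : ℝ} (hq : ∀ n, qPoch q q n ≠ 0) {u v : A}
    (h : v * u = q • (u * v)) (n : ℕ) :
    (u + v) ^ n = qPoch q q n • ∑ p ∈ antidiagonal n,
      ((qPoch q q p.1)⁻¹ * (qPoch q q p.2)⁻¹) • (u ^ p.1 * v ^ p.2) := by
  have hpow : ∀ i, v * u ^ i = q ^ i • (u ^ i * v) := by
    intro i
    induction i with
    | zero => simp
    | succ i ih =>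
      rw [pow_succ', ← mul_assoc, h, smul_mul_assoc, mul_assoc u v, ih, pow_succ']
      simp [smul_smul, mul_assoc]
  have hinv : ∀ i, (1 - q ^ (i + 1)) * (qPoch q q (i + 1))⁻¹ = (qPoch q q i)⁻¹ := by
    intro i
    have h := hq (i + 1)
    rw [qPoch_self_succ] at h ⊢
    have h1 := left_ne_zero_of_mul h
    have h2 := right_ne_zero_of_mul h
    field_simp
  induction n with
  | zero => simp [qPoch]
  | succ n ih =>
    rw [pow_succ', ih, qPoch_self_succ, mul_smul, mul_smul_comm]
    congr 1
    -- From `1 - q^(i+j) = (1 - q^i) + q^i (1 - q^j)`: the two sums correspond to multiplying by `u`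
    -- and by `v`.
    have hsplit : (1 - q ^ (n + 1)) • ∑ p ∈ antidiagonal (n + 1),
          ((qPoch q q p.1)⁻¹ * (qPoch q q p.2)⁻¹) • (u ^ p.1 * v ^ p.2) =
        (∑ p ∈ antidiagonal (n + 1), ((1 - q ^ p.1) *
          ((qPoch q q p.1)⁻¹ * (qPoch q q p.2)⁻¹)) • (u ^ p.1 * v ^ p.2)) +
        ∑ p ∈ antidiagonal (n + 1), (q ^ p.1 * (1 - q ^ p.2) *
          ((qPoch q q p.1)⁻¹ * (qPoch q q p.2)⁻¹)) • (u ^ p.1 * v ^ p.2) := by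
      rw [smul_sum, ← sum_add_distrib]
      refine sum_congr rfl fun p hp => ?_
      rw [← mem_antidiagonal.mp hp, smul_smul, ← add_smul]
      congr 1
      ring
    rw [hsplit, Finset.Nat.sum_antidiagonal_succ, Finset.Nat.sum_antidiagonal_succ', mul_sum]
    simp only [pow_zero, sub_self, zero_mul, mul_zero, zero_smul, zero_add]
    rw [← sum_add_distrib]
    refine sum_congr rfl fun p _ => ?_
    rw [mul_smul_comm, add_mul, smul_add]
    congr 1
    · rw [← mul_assoc (1 - _), hinv, pow_succ', mul_assoc]
    · rw [← mul_assoc, hpow, smul_mul_assoc, smul_smul, mul_assoc (u ^ p.1), ← pow_succ', ← hinv p.2]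
      congr 1
      ring

/-- Both sides expand to `P² + q (r + s) Q P + q r s Q²`, symmetric in `r` and `s`. -/
theorem pencil_mul_pencil {q : ℝ} {P Q : A} (h : P * Q = q • (Q * P)) (s r : ℝ) :
    (P + (q * s) • Q) * (P + r • Q) = (P + (q * r) • Q) * (P + s • Q) := by
  simp only [add_mul, mul_add, smul_mul_assoc, mul_smul_comm, h]
  match_scalars <;> ring

theorem pencil_pow_mul {q : ℝ} {P Q : A} (h : P * Q = q • (Q * P)) (s r : ℝ)
    (n : ℕ) :
    (P + (s * q) • Q) ^ n * (P + r • Q) = (P + (q ^ n * r) • Q) * (P + s • Q) ^ n := by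
  induction n generalizing r with
  | zero => simp
  | succ n ih =>
    rw [pow_succ, mul_assoc, mul_comm s q, pencil_mul_pencil h, ← mul_assoc, mul_comm q s, ih,
      mul_assoc, ← pow_succ (P + s • Q), pow_succ q n, mul_assoc (q ^ n)]

/-- A noncommutative `q`-Pfaff–Saalschütz summation: interpolation of the powers of a pencil
`P + r Q` of `q`-commuting elements. -/
theorem sum_pencil_pow {q : ℝ} (hq : ∀ n, qPoch q q n ≠ 0) {P Q : A}
    (h : P * Q = q • (Q * P)) (r s p : ℝ) (n : ℕ) :
    ∑ x ∈ antidiagonal n, (qDivPow q r p x.1 * qDivPow q s r x.2) •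
        ((P + s • Q) ^ x.1 * (P + p • Q) ^ x.2) =
      qDivPow q s p n • (P + r • Q) ^ n := by
  have hne : ∀ n, 1 - q ^ (n + 1) ≠ 0 := fun n => by
    have := hq (n + 1)
    rw [qPoch_self_succ] at this
    exact right_ne_zero_of_mul this
  induction n generalizing p with
  | zero => simp [qDivPow_zero]
  | succ n ih =>
    -- The split is chosen so that the first sum loses its term `x.1 = 0` and the second its term
    -- `x.2 = 0`. After the index shifts both run over `antidiagonal n` with the common factor of
    -- the induction hypothesis at `p q`.
    have key : (1 - q ^ (n + 1)) • ∑ x ∈ antidiagonal (n + 1),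
          (qDivPow q r p x.1 * qDivPow q s r x.2) •
            ((P + s • Q) ^ x.1 * (P + p • Q) ^ x.2) =
        (∑ x ∈ antidiagonal (n + 1),
          (((1 - q ^ (n + 1)) * qDivPow q r p x.1 - qDivPow q r (p * q) x.1 * (1 - q ^ x.2)) *
            qDivPow q s r x.2) • ((P + s • Q) ^ x.1 * (P + p • Q) ^ x.2)) +
        ∑ x ∈ antidiagonal (n + 1),
          (qDivPow q r (p * q) x.1 * ((1 - q ^ x.2) * qDivPow q s r x.2)) •
            ((P + s • Q) ^ x.1 * (P + p • Q) ^ x.2) := by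
      rw [smul_sum, ← sum_add_distrib]
      refine sum_congr rfl fun x _ => ?_
      rw [smul_smul, ← add_smul]
      congr 1
      ring
    refine smul_right_injective A (hne n) ?_
    simp only
    rw [key, Finset.Nat.sum_antidiagonal_succ, Finset.Nat.sum_antidiagonal_succ', smul_smul,
      qDivPow_succ' hq, mul_smul (s - p), pow_succ (P + r • Q), ← smul_mul_assoc (qDivPow q s (p * q) n),
      ← ih (p * q), sum_mul, smul_sum]
    simp only [qDivPow_zero, pow_zero, sub_self, zero_mul, mul_zero, zero_smul, zero_add,
      mul_one, one_mul]
    rw [← sum_add_distrib]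
    refine sum_congr rfl fun x hx => ?_
    rw [smul_mul_assoc, mul_assoc, pencil_pow_mul h]
    have e1 : ((1 - q ^ (n + 1)) * qDivPow q r p (x.1 + 1) -
        qDivPow q r (p * q) (x.1 + 1) * (1 - q ^ x.2)) =
        qDivPow q r (p * q) x.1 * (q ^ x.2 * r - p) := by
      have a1 := qDivPow_succ' hq r p x.1
      have a2 := qDivPow_succ hq r (p * q) x.1
      refine mul_left_cancel₀ (hne x.1) ?_
      rw [← mem_antidiagonal.mp hx]
      linear_combination (1 - q ^ (x.1 + x.2 + 1)) * a1 - (1 - q ^ x.2) * a2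
    -- What remains is linear interpolation at `t = q ^ x.2 * r`: `(s - p)(P + t Q) = (t - p)(P + s
    -- Q) + (s - t)(P + p Q)`.
    rw [e1, qDivPow_succ hq, pow_succ (P + s • Q), pow_succ' (P + p • Q)]
    simp only [add_mul, mul_add, smul_mul_assoc, mul_smul_comm, smul_add, smul_smul, mul_assoc]
    match_scalars <;> ring

end Algebra

end ZRP
end

/-! ### Fock operators as `q`-difference operators on power series. -/

noncomputable section
namespace ZRP
open Finset PowerSeries

/-- Multiplication of the Fock vectors, viewed as power series in `b₊`, by a power series. -/
def mulOp (f : ℝ⟦X⟧) : Module.End ℝ Fock where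
  toFun v := fun n => coeff n (f * PowerSeries.mk v)
  map_add' v w := by
    ext n
    simp [coeff_mul, mul_add, sum_add_distrib]
  map_smul' c v := by
    ext n
    simp [coeff_mul, mul_sum, mul_left_comm]

theorem mulOp_apply (f : ℝ⟦X⟧) (v : Fock) (n : ℕ) :
    mulOp f v n = ∑ p ∈ antidiagonal n, coeff p.1 f * v p.2 := by
  simp [mulOp, coeff_mul]

theorem mk_mulOp (f : ℝ⟦X⟧) (v : Fock) : PowerSeries.mk (mulOp f v) = f * PowerSeries.mk v := by
  ext n
  simp [mulOp]

theorem mulOp_mul (f g : ℝ⟦X⟧) : mulOp (f * g) = mulOp f * mulOp g := by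
  ext v n
  simp only [Module.End.mul_apply]
  change coeff n (f * g * _) = coeff n (f * PowerSeries.mk (mulOp g v))
  rw [mk_mulOp, mul_assoc]

theorem mulOp_one : mulOp 1 = 1 := by
  ext v n
  simp [mulOp]

theorem mulOp_add (f g : ℝ⟦X⟧) : mulOp (f + g) = mulOp f + mulOp g := by
  ext v n
  simp [mulOp, add_mul]

theorem mulOp_sub (f g : ℝ⟦X⟧) : mulOp (f - g) = mulOp f - mulOp g := by
  rw [eq_sub_iff_add_eq, ← mulOp_add, sub_add_cancel]

theorem mulOp_smul (c : ℝ) (f : ℝ⟦X⟧) : mulOp (c • f) = c • mulOp f := by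
  ext v n
  simp [mulOp]

theorem bPlus_eq_mulOp : bPlus = mulOp X := by
  ext v n
  cases n <;> simp [bPlus, mulOp, coeff_succ_X_mul]

theorem bPlus_pow_apply (j n : ℕ) (v : Fock) :
    (bPlus ^ j) v n = if j ≤ n then v (n - j) else 0 := by
  induction j generalizing n with
  | zero => simp
  | succ j ih =>
    rw [pow_succ']
    rcases n with _ | n
    · simp [bPlus]
    · simpa [bPlus] using ih n

theorem bPlusSeries_eq_mulOp (c : ℕ → ℝ) : bPlusSeries c = mulOp (PowerSeries.mk c) := by
  ext v n
  rw [mulOp_apply, Finset.Nat.sum_antidiagonal_eq_sum_range_succ_mk]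
  change ∑ j ∈ range (n + 1), c j * (bPlus ^ j) v n = _
  refine sum_congr rfl fun j hj => ?_
  rw [bPlus_pow_apply, if_pos (by simpa [Nat.lt_succ_iff] using hj)]
  simp

theorem kOp_mul_mulOp (q : ℝ) (f : ℝ⟦X⟧) : kOp q * mulOp f = mulOp (rescale q f) * kOp q := by
  ext v n
  simp only [Module.End.mul_apply, mulOp_apply, coeff_rescale]
  change q ^ n * mulOp f v n = _
  rw [mulOp_apply, mul_sum]
  refine sum_congr rfl fun p hp => ?_
  change _ = q ^ p.1 * _ * (q ^ p.2 * v p.2)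
  rw [← mem_antidiagonal.mp hp, pow_add]
  ring

theorem bPlus_mul_bMinus (q : ℝ) : bPlus * bMinus q = 1 - kOp q := by
  ext v n
  rcases n with _ | n
  · simp [bPlus, kOp]
  · simp [bPlus, bMinus, kOp]
    ring

/-- `b₊` is a shift, hence injective. Identities involving `b₋` are proved after multiplication by
`b₊`, where `b₊ b₋ = 1 - k` applies. -/
theorem bPlus_mul_left_cancel {x y : Module.End ℝ Fock} (h : bPlus * x = bPlus * y) : x = y := by
  ext v n
  have := congrFun (LinearMap.congr_fun h v) (n + 1)
  simpa [bPlus] using this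

theorem kOp_mul_bPlus (q : ℝ) : kOp q * bPlus = q • (bPlus * kOp q) := by
  rw [bPlus_eq_mulOp, kOp_mul_mulOp, rescale_X, ← smul_eq_C_mul, mulOp_smul, smul_mul_assoc]

theorem bMinus_mul_kOp (q : ℝ) : bMinus q * kOp q = q • (kOp q * bMinus q) := by
  ext v n
  simp [bMinus, kOp, pow_succ]
  ring

/-- The operator `(1 - b₊)⁻¹ k`. -/
def kappa (q : ℝ) : Module.End ℝ Fock := mulOp (1 - X : ℝ⟦X⟧)⁻¹ * kOp q

theorem one_sub_X_mul_inv : (1 - X : ℝ⟦X⟧) * (1 - X)⁻¹ = 1 :=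
  PowerSeries.mul_inv_cancel _ (by simp)

theorem kappa_sub (q : ℝ) : kappa q - bPlus * kappa q = kOp q := by
  have h : (1 - bPlus) = mulOp (1 - X) := by
    rw [mulOp_sub, mulOp_one, bPlus_eq_mulOp]
  rw [← one_sub_mul, h, kappa, ← mul_assoc, ← mulOp_mul, one_sub_X_mul_inv, mulOp_one, one_mul]

theorem kappa_mul_bPlus (q : ℝ) : kappa q * bPlus = q • (bPlus * kappa q) := by
  rw [kappa, mul_assoc, kOp_mul_bPlus, mul_smul_comm, ← mul_assoc, ← mul_assoc, bPlus_eq_mulOp,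
    ← mulOp_mul, ← mulOp_mul, mul_comm]

/-- On series `f(z)`, with `b₊ = z`, the operators are `b₋ f = (f(z) - f(qz)) / z` and `κ f = f(qz)
/ (1 - z)`; the term `b₊ κ` completes `k` to `κ`. -/
theorem bPlus_mul_bMinus_sub_kappa (q : ℝ) : bPlus * (bMinus q - kappa q) = 1 - kappa q := by
  rw [mul_sub, bPlus_mul_bMinus, ← kappa_sub]
  abel

theorem bMinus_sub_kappa_mul_bPlus (q : ℝ) :
    (bMinus q - kappa q) * bPlus = 1 - q • kappa q := by
  apply bPlus_mul_left_cancel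
  rw [← mul_assoc, bPlus_mul_bMinus_sub_kappa, sub_mul, kappa_mul_bPlus, mul_sub, mul_smul_comm,
    one_mul, mul_one]

theorem bMinus_sub_kappa_mul_kappa (q : ℝ) :
    (bMinus q - kappa q) * kappa q = q • (kappa q * (bMinus q - kappa q)) := by
  apply bPlus_mul_left_cancel
  rw [← mul_assoc, bPlus_mul_bMinus_sub_kappa, mul_smul_comm, ← mul_assoc, ← smul_mul_assoc,
    ← kappa_mul_bPlus, mul_assoc, bPlus_mul_bMinus_sub_kappa, sub_mul, mul_sub, one_mul, mul_one]

/-! ### The pencil with a central indeterminate and its generating functions. -/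

section Pencil

theorem C_mul_X_mul_C_mul_X {A : Type*} [Ring A] (a b : A) :
    (Polynomial.C a * Polynomial.X) * (Polynomial.C b * Polynomial.X) =
      Polynomial.C (a * b) * Polynomial.X ^ 2 := by
  rw [mul_assoc, ← mul_assoc Polynomial.X, Polynomial.X_mul_C, Polynomial.C_mul, pow_two]
  simp only [mul_assoc]

theorem C_mul_X_mul_C {A : Type*} [Ring A] (a b : A) :
    (Polynomial.C a * Polynomial.X) * Polynomial.C b =
      Polynomial.C (a * b) * Polynomial.X := by
  rw [mul_assoc, Polynomial.X_mul_C, ← mul_assoc, Polynomial.C_mul]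

theorem pow_mul_of_mul_eq {A : Type*} [Ring A] {x y D : A} (h : x * D = D * y) (n : ℕ) : x ^ n * D = D * y ^ n := by
  induction n with
  | zero => simp
  | succ n ih => rw [pow_succ, mul_assoc, h, ← mul_assoc, ih, mul_assoc, ← pow_succ]

variable {A : Type*} [Ring A] [Algebra ℝ A]

/-- The polynomials `(b - κ) x + κ` and `κ x - z κ` built from `q`-difference operators
`q`-commute. -/
theorem pencil_qCommute {q : ℝ} {b κ z : A}
    (h0 : (b - κ) * κ = q • (κ * (b - κ))) (h1 : (b - κ) * z = 1 - q • κ)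
    (h2 : z * (b - κ) = 1 - κ) (h3 : κ * z = q • (z * κ)) :
    (Polynomial.C (b - κ) * Polynomial.X + Polynomial.C κ) *
        (Polynomial.C κ * Polynomial.X - Polynomial.C (z * κ)) =
      q • ((Polynomial.C κ * Polynomial.X - Polynomial.C (z * κ)) *
        (Polynomial.C (b - κ) * Polynomial.X + Polynomial.C κ)) := by
  generalize b - κ = B at *
  have e1 : B * (z * κ) = κ - q • (κ * κ) := by
    rw [← mul_assoc, h1, sub_mul, one_mul, smul_mul_assoc]
  have e2 : q • (z * κ * B) = κ - κ * κ := by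
    rw [← smul_mul_assoc, ← h3, mul_assoc, h2, mul_sub, mul_one]
  have e3 : κ * (z * κ) = q • (z * κ * κ) := by
    rw [← mul_assoc, h3, smul_mul_assoc]
  have l : (Polynomial.C B * Polynomial.X + Polynomial.C κ) *
        (Polynomial.C κ * Polynomial.X - Polynomial.C (z * κ)) =
      Polynomial.C (B * κ) * Polynomial.X ^ 2 +
        Polynomial.C (κ * κ - B * (z * κ)) * Polynomial.X - Polynomial.C (κ * (z * κ)) := by
    rw [add_mul, mul_sub, mul_sub, C_mul_X_mul_C_mul_X, C_mul_X_mul_C, ← mul_assoc (Polynomial.C κ),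
      ← Polynomial.C_mul, ← Polynomial.C_mul, Polynomial.C_sub, sub_mul]
    abel
  have r : (Polynomial.C κ * Polynomial.X - Polynomial.C (z * κ)) *
        (Polynomial.C B * Polynomial.X + Polynomial.C κ) =
      Polynomial.C (κ * B) * Polynomial.X ^ 2 +
        Polynomial.C (κ * κ - z * κ * B) * Polynomial.X - Polynomial.C (z * κ * κ) := by
    rw [sub_mul, mul_add, mul_add, C_mul_X_mul_C_mul_X, C_mul_X_mul_C, ← mul_assoc (Polynomial.C _),
      ← Polynomial.C_mul, ← Polynomial.C_mul, Polynomial.C_sub, sub_mul]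
    abel
  rw [l, r, smul_sub, smul_add, ← smul_mul_assoc, ← smul_mul_assoc, Polynomial.smul_C,
    Polynomial.smul_C, Polynomial.smul_C, ← h0, ← e3, smul_sub, e1, e2]
  congr 4
  abel

/-- Moving `D` to the left only changes the parameter of the pencil, from `1` (see `linGen_eq`) to
`s`. -/
theorem linGen_mul_C {b k κ z D : A} {s : ℝ}
    (hkD : k * D = D * (κ - s • (z * κ))) (hbD : b * D = D * (b + (s - 1) • κ)) :
    (Polynomial.C k + Polynomial.C b * Polynomial.X) * Polynomial.C D =
      Polynomial.C D * ((Polynomial.C (b - κ) * Polynomial.X + Polynomial.C κ) +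
        s • (Polynomial.C κ * Polynomial.X - Polynomial.C (z * κ))) := by
  rw [add_mul, C_mul_X_mul_C, ← Polynomial.C_mul, hkD, hbD, sub_smul, one_smul]
  rw [smul_sub, ← smul_mul_assoc s (Polynomial.C κ), Polynomial.smul_C, Polynomial.smul_C]
  simp only [Polynomial.C_mul, Polynomial.C_add, Polynomial.C_sub, mul_add, mul_sub, add_mul,
    sub_mul, mul_assoc]
  abel

theorem linGen_eq {b k κ z : A} (hk : κ - z * κ = k) :
    (Polynomial.C k + Polynomial.C b * Polynomial.X) =
      (Polynomial.C (b - κ) * Polynomial.X + Polynomial.C κ) +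
        (1 : ℝ) • (Polynomial.C κ * Polynomial.X - Polynomial.C (z * κ)) := by
  rw [one_smul, ← hk, Polynomial.C_sub, Polynomial.C_sub, sub_mul]
  abel

/-- The `q`-binomial theorem for `b X` and `k`; the exponent of the indeterminate counts the factors
`b`. -/
theorem coeff_linGen_pow {q : ℝ} (hq : ∀ n, qPoch q q n ≠ 0) {b k : A}
    (h : b * k = q • (k * b)) (n l : ℕ) :
    ((Polynomial.C k + Polynomial.C b * Polynomial.X) ^ n).coeff l =
      if l ≤ n then (qPoch q q n * ((qPoch q q (n - l))⁻¹ * (qPoch q q l)⁻¹)) •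
        (k ^ (n - l) * b ^ l) else 0 := by
  have hc : (Polynomial.C b * Polynomial.X) * Polynomial.C k =
      q • (Polynomial.C k * (Polynomial.C b * Polynomial.X)) := by
    rw [C_mul_X_mul_C, h, ← mul_assoc, ← Polynomial.C_mul,
      ← smul_mul_assoc q (Polynomial.C (k * b)), Polynomial.smul_C]
  have hx : ∀ j, (Polynomial.C b * Polynomial.X) ^ j = Polynomial.C (b ^ j) * Polynomial.X ^ j := by
    intro j
    rw [Polynomial.C_pow, (Polynomial.commute_X (Polynomial.C b)).symm.mul_pow]
  rw [add_pow_of_qCommute hq hc, Polynomial.coeff_smul, Polynomial.finsetSum_coeff]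
  have ht : ∀ p : ℕ × ℕ, (((qPoch q q p.1)⁻¹ * (qPoch q q p.2)⁻¹) •
      (Polynomial.C k ^ p.1 * (Polynomial.C b * Polynomial.X) ^ p.2)).coeff l =
      if l = p.2 then ((qPoch q q p.1)⁻¹ * (qPoch q q p.2)⁻¹) • (k ^ p.1 * b ^ p.2) else 0 := by
    intro p
    rw [hx, ← mul_assoc, ← Polynomial.C_pow, ← Polynomial.C_mul, Polynomial.coeff_smul,
      Polynomial.coeff_C_mul_X_pow]
    split_ifs <;> simp
  simp only [ht]
  split_ifs with hl
  · rw [sum_eq_single (n - l, l), if_pos rfl, smul_smul]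
    · intro p hp hne
      rw [if_neg]
      rintro rfl
      apply hne
      ext
      · simp [← mem_antidiagonal.mp hp]
      · rfl
    · intro hn
      simp [Nat.sub_add_cancel hl] at hn
  · rw [sum_eq_zero, smul_zero]
    intro p hp
    rw [if_neg]
    rintro rfl
    exact hl (by simp [← mem_antidiagonal.mp hp])

/-- The exchange relation in generating function form. -/
theorem sum_linGen_pow_mul {q : ℝ} (hq : ∀ n, qPoch q q n ≠ 0) {b k κ z D E : A} {r s : ℝ}
    (h0 : (b - κ) * κ = q • (κ * (b - κ))) (h1 : (b - κ) * z = 1 - q • κ)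
    (h2 : z * (b - κ) = 1 - κ) (h3 : κ * z = q • (z * κ)) (hk : κ - z * κ = k)
    (hkD : k * D = D * (κ - s • (z * κ))) (hbD : b * D = D * (b + (s - 1) • κ))
    (hkE : k * E = E * (κ - r • (z * κ))) (hbE : b * E = E * (b + (r - 1) • κ))
    (hDE : E * D = D * E) (n : ℕ) :
    Polynomial.C E * ∑ x ∈ antidiagonal n, (qDivPow q r 1 x.1 * qDivPow q s r x.2) •
        ((Polynomial.C k + Polynomial.C b * Polynomial.X) ^ x.1 * Polynomial.C D *
          (Polynomial.C k + Polynomial.C b * Polynomial.X) ^ x.2) =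
      qDivPow q s 1 n • (Polynomial.C D *
        (Polynomial.C k + Polynomial.C b * Polynomial.X) ^ n * Polynomial.C E) := by
  have hP := pencil_qCommute h0 h1 h2 h3
  have hD := linGen_mul_C hkD hbD
  have hE := linGen_mul_C hkE hbE
  rw [mul_assoc (Polynomial.C D), pow_mul_of_mul_eq hE, ← mul_assoc (Polynomial.C D),
    ← mul_smul_comm, ← sum_pencil_pow hq hP r s 1 n, mul_sum, mul_sum]
  refine sum_congr rfl fun x _ => ?_
  rw [pow_mul_of_mul_eq hD, mul_smul_comm, mul_smul_comm, ← linGen_eq hk, mul_assoc, ← mul_assoc,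
    ← Polynomial.C_mul, ← Polynomial.C_mul, hDE]

end Pencil

/-! ### The series `(b₊)_∞ / (mu⁻¹ b₊)_∞` and the exchange relation. -/

theorem coeff_dilog {q : ℝ} {mu : ℝ} (hmu : mu ≠ 0) (j : ℕ) :
    qPoch q mu j / qPoch q q j * mu⁻¹ ^ j = qDivPow q mu⁻¹ 1 j := by
  rw [qDivPow_inv hmu]
  ring

/-- The power series `(X)_∞ / (mu⁻¹ X)_∞`. -/
def dilogSeries (q mu : ℝ) : ℝ⟦X⟧ :=
  PowerSeries.mk fun j => qPoch q mu j / qPoch q q j * mu⁻¹ ^ j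

theorem dilogOp_eq_mulOp (q mu : ℝ) : dilogOp q mu = mulOp (dilogSeries q mu) :=
  bPlusSeries_eq_mulOp _

/-- The functional equation `F(qz)(1 - z) = F(z)(1 - z/mu)`, which is the coefficient recurrence
`qDivPow_succ`. It governs how `k` and `b₋` pass through `dilogOp`. -/
theorem rescale_dilogSeries {q mu : ℝ} (hq : ∀ n, qPoch q q n ≠ 0) (hmu : mu ≠ 0) :
    rescale q (dilogSeries q mu) * (1 - X) = dilogSeries q mu * (1 - PowerSeries.C mu⁻¹ * X) := by
  ext (_ | n)
  · simp only [mul_sub, map_sub, coeff_rescale, mul_one,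
      coeff_zero_mul_X, ← mul_assoc, pow_zero, one_mul]
  · have h := qDivPow_succ hq mu⁻¹ 1 n
    rw [mul_sub, mul_sub, ← mul_assoc, mul_comm _ (PowerSeries.C mu⁻¹), mul_assoc]
    simp only [map_sub, mul_one, coeff_succ_mul_X, coeff_rescale, coeff_C_mul, dilogSeries, coeff_mk,
      coeff_dilog hmu]
    linear_combination -h

theorem kOp_mul_dilogOp {q mu : ℝ} (hq : ∀ n, qPoch q q n ≠ 0) (hmu : mu ≠ 0) :
    kOp q * dilogOp q mu = dilogOp q mu * (kappa q - mu⁻¹ • (bPlus * kappa q)) := by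
  have h : kappa q - mu⁻¹ • (bPlus * kappa q) =
      mulOp ((1 - PowerSeries.C mu⁻¹ * X) * (1 - X)⁻¹) * kOp q := by
    rw [kappa, ← mul_assoc, bPlus_eq_mulOp, ← mulOp_mul, ← smul_mul_assoc, ← mulOp_smul, ← sub_mul,
      ← mulOp_sub, sub_mul, one_mul, smul_eq_C_mul, mul_assoc]
  rw [h, dilogOp_eq_mulOp, kOp_mul_mulOp, ← mul_assoc, ← mulOp_mul, ← mul_assoc,
    ← rescale_dilogSeries hq hmu, mul_assoc, one_sub_X_mul_inv, mul_one]

theorem dilogOp_mul_comm_bPlus (q mu : ℝ) : dilogOp q mu * bPlus = bPlus * dilogOp q mu := by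
  rw [dilogOp_eq_mulOp, bPlus_eq_mulOp, ← mulOp_mul, ← mulOp_mul, mul_comm]

theorem dilogOp_mul_comm (q lam mu : ℝ) :
    dilogOp q lam * dilogOp q mu = dilogOp q mu * dilogOp q lam := by
  rw [dilogOp_eq_mulOp, dilogOp_eq_mulOp, ← mulOp_mul, ← mulOp_mul, mul_comm]

theorem bMinus_mul_dilogOp {q mu : ℝ} (hq : ∀ n, qPoch q q n ≠ 0) (hmu : mu ≠ 0) :
    bMinus q * dilogOp q mu = dilogOp q mu * (bMinus q + (mu⁻¹ - 1) • kappa q) := by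
  apply bPlus_mul_left_cancel
  rw [← mul_assoc, bPlus_mul_bMinus, sub_mul, one_mul, kOp_mul_dilogOp hq hmu, ← mul_assoc,
    ← dilogOp_mul_comm_bPlus, mul_assoc, mul_add, bPlus_mul_bMinus, ← kappa_sub, mul_smul_comm,
    ← mul_one_sub]
  congr 1
  module

/-- `k^{α_2} b₋^{α_1}`. -/
def eOp (q : ℝ) (α : Local 2) : Module.End ℝ Fock := kOp q ^ α 1 * bMinus q ^ α 0

theorem zOp_eq (q mu : ℝ) (α : Local 2) : zOp q mu α = dilogOp q mu * eOp q α := mul_assoc _ _ _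

/-- `mu^(-|δ|) (mu / lam)_{|δ|} / ∏_i (q)_{δ_i}`. -/
def hWeight (q : ℝ) {n : ℕ} (lam mu : ℝ) (δ : Local n) : ℝ :=
  mu⁻¹ ^ size δ * qPoch q (mu / lam) (size δ) / ∏ i, qPoch q q (δ i)

theorem size_two (α : Local 2) : size α = α 0 + α 1 := by simp [size]

/-- The exchange relation of the `Z` operators with `(b₊)_∞ / (lam⁻¹ b₊)_∞`. -/
theorem dilogOp_exchange {q lam mu : ℝ} (hq : ∀ n, qPoch q q n ≠ 0) (hlam : lam ≠ 0)
    (hmu : mu ≠ 0) (α : Local 2) :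
    dilogOp q lam * ∑ γ ∈ Iic α, (gWeight q lam γ * hWeight q lam mu (α - γ)) •
        (eOp q γ * dilogOp q mu * eOp q (α - γ)) =
      gWeight q mu α • (zOp q mu α * dilogOp q lam) := by
  -- Total degree `size α` and degree `α 0` in the indeterminate single out `α`. The pencil
  -- parameters are `s = mu⁻¹` and `r = lam⁻¹`.
  have key := congrArg (fun p => p.coeff (α 0)) (sum_linGen_pow_mul hq (bMinus_sub_kappa_mul_kappa q)
    (bMinus_sub_kappa_mul_bPlus q) (bPlus_mul_bMinus_sub_kappa q) (kappa_mul_bPlus q) (kappa_sub q)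
    (kOp_mul_dilogOp hq hmu) (bMinus_mul_dilogOp hq hmu) (kOp_mul_dilogOp hq hlam)
    (bMinus_mul_dilogOp hq hlam) (dilogOp_mul_comm q lam mu) (size α))
  have hmul : ∀ (f g : Polynomial (Module.End ℝ Fock)) (D : Module.End ℝ Fock) (l : ℕ),
      (f * Polynomial.C D * g).coeff l =
        ∑ x ∈ antidiagonal l, f.coeff x.1 * D * g.coeff x.2 := by
    intro f g D l
    simp only [Polynomial.coeff_mul _ g, Polynomial.coeff_mul_C]
  simp only [Polynomial.coeff_C_mul, Polynomial.finsetSum_coeff, Polynomial.coeff_smul,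
    Polynomial.coeff_mul_C, hmul, smul_sum, ← sum_product',
    coeff_linGen_pow hq (bMinus_mul_kOp q)] at key
  have hs : size α - α 0 = α 1 := by simp [size_two]
  rw [if_pos (by simp [size_two]), hs] at key
  have hR : gWeight q mu α • (zOp q mu α * dilogOp q lam) =
      qDivPow q mu⁻¹ 1 (size α) • (dilogOp q mu * ((qPoch q q (size α) *
        ((qPoch q q (α 1))⁻¹ * (qPoch q q (α 0))⁻¹)) • (kOp q ^ α 1 * bMinus q ^ α 0)) *
          dilogOp q lam) := by
    rw [zOp_eq, eOp, mul_smul_comm, smul_mul_assoc, smul_smul, gWeight, qDivPow_inv hmu]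
    congr 1
    have := hq (size α)
    simp only [Fin.prod_univ_two]
    field_simp
  rw [hR, ← key]
  congr 1
  -- A local state `γ` is recorded by its size and its species-0 count. Index pairs outside the
  -- image have more factors `b₋` than the power allows, so their coefficient is zero.
  refine sum_of_injOn (fun γ => ((size γ, size α - size γ), (γ 0, α 0 - γ 0))) ?_ ?_ ?_ ?_
  · intro γ _ δ _ h
    simp only [Prod.mk.injEq, size_two] at h
    ext i
    fin_cases i
    · exact h.2.1
    · have := h.1.1
      have := h.2.1
      change γ 1 = δ 1
      omega
  · intro γ hγ
    have h0 : γ 0 ≤ α 0 := (mem_Iic.mp (mem_coe.mp hγ)) 0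
    have h1 : γ 1 ≤ α 1 := (mem_Iic.mp (mem_coe.mp hγ)) 1
    have := size_two α
    have := size_two γ
    simp
    omega
  · rintro ⟨⟨M, K⟩, ⟨a, b⟩⟩ hx hn
    simp only [mem_product, HasAntidiagonal.mem_antidiagonal] at hx
    by_cases hM : a ≤ M
    · by_cases hK : b ≤ K
      · exfalso
        refine hn ⟨![a, M - a], ?_, ?_⟩
        · rw [mem_coe, mem_Iic]
          intro i
          have := size_two α
          fin_cases i
          · simp; omega
          · simp; omega
        · simp [size_two]
          omega
      · simp [if_neg hK]
    · simp [if_neg hM]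
  · intro γ hγ
    have h0 : γ 0 ≤ α 0 := (mem_Iic.mp hγ) 0
    have h1 : γ 1 ≤ α 1 := (mem_Iic.mp hγ) 1
    have hsz : size α - size γ = size (α - γ) := by
      rw [size_two, size_two, size_two, Pi.sub_apply, Pi.sub_apply]
      omega
    have e1 : size γ - γ 0 = γ 1 := by simp [size_two]
    have e2 : size (α - γ) - (α 0 - γ 0) = α 1 - γ 1 := by simp [size_two]
    simp only
    rw [hsz, if_pos (by simp [size_two]), if_pos (by simp [size_two]), e1, e2]
    simp only [mul_smul_comm, smul_mul_assoc, smul_smul, eOp, gWeight, hWeight, qDivPow_inv hlam,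
      qDivPow_inv_inv hmu, Fin.prod_univ_two, Pi.sub_apply]
    congr 1
    have := hq (size γ)
    have := hq (size (α - γ))
    field_simp

end ZRP
end

/-! ### Band operators, convergence and cyclicity of the trace. -/

noncomputable section
namespace ZRP
open Finset

/-- The operator `X` on the completed Fock space has row-finite matrix elements `⟨n| X |j⟩` which
vanish for `j > n + d` and are `O(q ^ (e n))` along each diagonal. -/
def IsBand (q : ℝ) (X : Module.End ℝ Fock) (d e : ℕ) : Prop :=
  ∃ a : ℕ → ℕ → ℝ, (∀ v n, X v n = ∑ p ∈ antidiagonal (n + d), a p.1 n * v p.2) ∧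
    ∀ t, ∃ C, ∀ n, |a t n| ≤ C * q ^ (e * n)

theorem sum_antidiagonal_add_right (n d : ℕ) (f : ℕ × ℕ → ℝ) :
    ∑ p ∈ antidiagonal n, f (p.1, p.2 + d) =
      ∑ p ∈ antidiagonal (n + d), if p.1 ≤ n then f p else 0 := by
  refine sum_of_injOn (fun p => (p.1, p.2 + d)) ?_ ?_ ?_ ?_
  · rintro ⟨a, b⟩ _ ⟨a', b'⟩ _ h
    simpa using h
  · rintro ⟨a, b⟩ h
    simp only [mem_coe, HasAntidiagonal.mem_antidiagonal] at h ⊢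
    omega
  · rintro ⟨a, b⟩ h hn
    rw [HasAntidiagonal.mem_antidiagonal] at h
    refine if_neg fun hle => hn ⟨(a, b - d), ?_, ?_⟩
    · simp only [mem_coe, HasAntidiagonal.mem_antidiagonal] at h hle ⊢
      omega
    · simp only [Prod.mk.injEq, true_and] at h hle ⊢
      omega
  · rintro ⟨a, b⟩ h
    rw [HasAntidiagonal.mem_antidiagonal] at h
    exact (if_pos (by simp only at h ⊢; omega)).symm

theorem IsBand.mul {q : ℝ} (hq0 : 0 < q) (hq1 : q < 1) {X Y : Module.End ℝ Fock} {d e d' e' : ℕ}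
    (hX : IsBand q X d e) (hY : IsBand q Y d' e') : IsBand q (X * Y) (d + d') (e + e') := by
  obtain ⟨a, ha, hA⟩ := hX
  obtain ⟨b, hb, hB⟩ := hY
  refine ⟨fun t n => ∑ p ∈ antidiagonal t,
    if p.1 ≤ n + d then a p.1 n * b p.2 (n + d - p.1) else 0, fun v n => ?_, fun t => ?_⟩
  · rw [Module.End.mul_apply, ha]
    have h1 : ∀ p ∈ antidiagonal (n + d), a p.1 n * Y v p.2 =
        (fun x : ℕ × ℕ => a x.1 n * ∑ r ∈ antidiagonal x.2, b r.1 (n + d - x.1) * v r.2)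
          (p.1, p.2 + d') := by
      intro p hp
      rw [hb, ← HasAntidiagonal.mem_antidiagonal.mp hp]
      simp only [Nat.add_sub_cancel_left]
    rw [sum_congr rfl h1]
    refine (sum_antidiagonal_add_right (n + d) d' (fun x : ℕ × ℕ =>
      a x.1 n * ∑ r ∈ antidiagonal x.2, b r.1 (n + d - x.1) * v r.2)).trans ?_
    rw [← add_assoc]
    simp only [sum_mul, mul_sum, ite_sum_zero]
    rw [sum_sigma', sum_sigma']
    refine sum_nbij' (fun x => ⟨(x.1.1 + x.2.1, x.2.2), (x.1.1, x.2.1)⟩)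
      (fun x => ⟨(x.2.1, x.2.2 + x.1.2), (x.2.2, x.1.2)⟩) ?_ ?_ ?_ ?_ ?_
    · rintro ⟨⟨i, j⟩, ⟨k, l⟩⟩
      simp
      omega
    · rintro ⟨⟨i, j⟩, ⟨k, l⟩⟩
      simp
      omega
    · rintro ⟨⟨i, j⟩, ⟨k, l⟩⟩
      simp +contextual
    · rintro ⟨⟨i, j⟩, ⟨k, l⟩⟩
      simp +contextual
    · rintro ⟨⟨i, j⟩, ⟨k, l⟩⟩ _
      dsimp only
      split_ifs <;> ring
  · choose C hC using hA
    choose C' hC' using hB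
    have hC0 : ∀ t, 0 ≤ C t := fun t => by simpa using (abs_nonneg _).trans (hC t 0)
    have hC0' : ∀ t, 0 ≤ C' t := fun t => by simpa using (abs_nonneg _).trans (hC' t 0)
    refine ⟨∑ p ∈ antidiagonal t, C p.1 * C' p.2 * (q ^ (e' * p.1))⁻¹, fun n => ?_⟩
    rw [sum_mul]
    refine (abs_sum_le_sum_abs _ _).trans (sum_le_sum fun p _ => ?_)
    have hpos : 0 < q ^ (e' * p.1) := pow_pos hq0 _
    split_ifs with hle
    · rw [abs_mul]
      refine (mul_le_mul (hC _ _) (hC' _ _) (abs_nonneg _) (by have := hC0 p.1; positivity)).trans ?_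
      -- The decay of `Y` is in the row `n + d - p.1`, at least `n - p.1`; the loss is a constant
      -- because `p.1 ≤ t` is bounded.
      have h1 : q ^ (e' * (n + d - p.1)) ≤ (q ^ (e' * p.1))⁻¹ * q ^ (e' * n) := by
        rw [le_inv_mul_iff₀ hpos, ← pow_add]
        refine pow_le_pow_of_le_one hq0.le hq1.le ?_
        rw [← mul_add]
        exact Nat.mul_le_mul_left _ (by omega)
      calc C p.1 * q ^ (e * n) * (C' p.2 * q ^ (e' * (n + d - p.1)))
          = C p.1 * C' p.2 * q ^ (e * n) * q ^ (e' * (n + d - p.1)) := by ring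
        _ ≤ C p.1 * C' p.2 * q ^ (e * n) * ((q ^ (e' * p.1))⁻¹ * q ^ (e' * n)) := by
            have := hC0 p.1
            have := hC0' p.2
            gcongr
        _ = _ := by ring
    · have := hC0 p.1
      have := hC0' p.2
      rw [abs_zero]
      positivity

theorem isBand_one (q : ℝ) : IsBand q 1 0 0 := by
  refine ⟨fun t _ => if t = 0 then 1 else 0, fun v n => ?_, fun t => ⟨1, fun n => ?_⟩⟩
  · rw [Finset.Nat.antidiagonal_eq_map, sum_map, sum_eq_single 0] <;> simp +contextual
  · dsimp only
    split_ifs <;> simp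

theorem isBand_mulOp (q : ℝ) (f : PowerSeries ℝ) : IsBand q (mulOp f) 0 0 :=
  ⟨fun t _ => PowerSeries.coeff t f, fun v n => mulOp_apply f v n, fun _ => ⟨_, fun _ => by
    simpa using le_refl _⟩⟩

theorem isBand_kOp {q : ℝ} (hq0 : 0 < q) : IsBand q (kOp q) 0 1 := by
  refine ⟨fun t n => if t = 0 then q ^ n else 0, fun v n => ?_, fun t => ⟨1, fun n => ?_⟩⟩
  · rw [Finset.Nat.antidiagonal_eq_map, sum_map, sum_eq_single 0] <;> simp +contextual [kOp]
  · have := pow_pos hq0 n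
    dsimp only
    split_ifs <;> simp [abs_of_pos, this, this.le]

theorem isBand_bMinus {q : ℝ} (hq0 : 0 < q) (hq1 : q < 1) : IsBand q (bMinus q) 1 0 := by
  refine ⟨fun t n => if t = 0 then 1 - q ^ (n + 1) else 0, fun v n => ?_, fun t => ⟨1, fun n => ?_⟩⟩
  · rw [Finset.Nat.antidiagonal_eq_map, sum_map, sum_eq_single 0]
    · simp
      rfl
    · intro i _ hi
      change (if i = 0 then _ else _) * _ = _
      rw [if_neg hi, zero_mul]
    · simp
  · have h1 := pow_pos hq0 (n + 1)
    have h2 := pow_le_one₀ hq0.le hq1.le (n := n + 1)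
    dsimp only
    split_ifs
    · rw [abs_of_nonneg (by linarith)]
      simp
      exact (pow_pos hq0 _).le
    · simp

theorem IsBand.pow {q : ℝ} (hq0 : 0 < q) (hq1 : q < 1) {X : Module.End ℝ Fock} {d e : ℕ}
    (hX : IsBand q X d e) (n : ℕ) : IsBand q (X ^ n) (n * d) (n * e) := by
  induction n with
  | zero => simpa using isBand_one q
  | succ n ih =>
    rw [pow_succ, add_mul, add_mul, one_mul, one_mul]
    exact ih.mul hq0 hq1 hX

theorem IsBand.smul {q : ℝ} {X : Module.End ℝ Fock} {d e : ℕ}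
    (hX : IsBand q X d e) (c : ℝ) : IsBand q (c • X) d e := by
  obtain ⟨a, ha, hA⟩ := hX
  refine ⟨fun t n => c * a t n, fun v n => ?_, fun t => ?_⟩
  · simp [ha, mul_sum, mul_assoc]
  · obtain ⟨C, hC⟩ := hA t
    refine ⟨|c| * C, fun n => ?_⟩
    rw [abs_mul, mul_assoc]
    exact mul_le_mul_of_nonneg_left (hC n) (abs_nonneg c)

theorem isBand_list_prod {q : ℝ} (hq0 : 0 < q) (hq1 : q < 1) {L : ℕ}
    (X : Fin L → Module.End ℝ Fock) (d e : Fin L → ℕ) (h : ∀ i, IsBand q (X i) (d i) (e i)) :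
    IsBand q (List.ofFn X).prod (∑ i, d i) (∑ i, e i) := by
  induction L with
  | zero => simpa using isBand_one q
  | succ L ih =>
    rw [List.ofFn_succ, List.prod_cons, Fin.sum_univ_succ, Fin.sum_univ_succ]
    exact (h 0).mul hq0 hq1 (ih _ _ _ fun i => h i.succ)

/-- The matrix element `⟨n| X |j⟩` divided by `(q)_n`. -/
def matElem (X : Module.End ℝ Fock) (n j : ℕ) : ℝ := X (ket j) n

theorem traceTerm_eq {q : ℝ} (hq : ∀ n, qPoch q q n ≠ 0) (X : Module.End ℝ Fock) (n : ℕ) :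
    traceTerm q X n = matElem X n n := by
  simp [traceTerm, bra, matElem, hq n]

theorem matElem_eq {X : Module.End ℝ Fock} {d : ℕ} {a : ℕ → ℕ → ℝ}
    (h : ∀ v n, X v n = ∑ p ∈ antidiagonal (n + d), a p.1 n * v p.2) (n j : ℕ) :
    matElem X n j = if j ≤ n + d then a (n + d - j) n else 0 := by
  rw [matElem, h]
  split_ifs with hj
  · rw [sum_eq_single (n + d - j, j)]
    · simp [ket]
    · rintro ⟨t, i⟩ hp hne
      rw [HasAntidiagonal.mem_antidiagonal] at hp
      have : i ≠ j := by
        rintro rfl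
        apply hne
        simp only [Prod.mk.injEq, and_true] at hp ⊢
        omega
      simp [ket, this]
    · intro hn
      simp [Nat.sub_add_cancel hj] at hn
  · refine sum_eq_zero ?_
    rintro ⟨t, i⟩ hp
    rw [HasAntidiagonal.mem_antidiagonal] at hp
    have : i ≠ j := by
      simp only at hp
      omega
    simp [ket, this]

theorem IsBand.hasSum_matElem {q : ℝ} {X : Module.End ℝ Fock} {d e : ℕ} (hX : IsBand q X d e)
    (v : Fock) (n : ℕ) : HasSum (fun j => matElem X n j * v j) (X v n) := by
  obtain ⟨a, ha, -⟩ := hX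
  have h : X v n = ∑ j ∈ range (n + d + 1), matElem X n j * v j := by
    rw [ha, ← Finset.Nat.sum_antidiagonal_swap,
      Finset.Nat.sum_antidiagonal_eq_sum_range_succ_mk]
    refine sum_congr rfl fun j hj => ?_
    rw [matElem_eq ha, if_pos (by simpa [Nat.lt_succ_iff] using hj)]
    rfl
  rw [h]
  refine hasSum_sum_of_ne_finset_zero fun j hj => ?_
  rw [matElem_eq ha, if_neg (by simpa [Nat.lt_succ_iff] using hj), zero_mul]

theorem IsBand.abs_matElem_le {q : ℝ} (hq0 : 0 < q) {X : Module.End ℝ Fock} {d e : ℕ}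
    (hX : IsBand q X d e) (T : ℕ) :
    ∃ C, 0 ≤ C ∧ ∀ n j, n ≤ j + T → |matElem X n j| ≤ C * q ^ (e * n) := by
  obtain ⟨a, ha, hA⟩ := hX
  choose C hC using hA
  have hC0 : ∀ t, 0 ≤ C t := fun t => by simpa using (abs_nonneg _).trans (hC t 0)
  refine ⟨∑ t ∈ range (T + d + 1), C t, sum_nonneg fun t _ => hC0 t, fun n j hnj => ?_⟩
  rw [matElem_eq ha]
  split_ifs with h
  · refine (hC _ _).trans (mul_le_mul_of_nonneg_right ?_ (by positivity))
    exact single_le_sum (f := C) (fun t _ => hC0 t) (mem_range.mpr (by omega))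
  · rw [abs_zero]
    exact mul_nonneg (sum_nonneg fun t _ => hC0 t) (by positivity)

theorem IsBand.matElem_eq_zero {q : ℝ} {X : Module.End ℝ Fock} {d e : ℕ} (hX : IsBand q X d e)
    {n j : ℕ} (h : n + d < j) : matElem X n j = 0 := by
  obtain ⟨a, ha, -⟩ := hX
  rw [matElem_eq ha, if_neg (by omega)]

/-- The diagonal entries are `O(q ^ (e n))`, dominated by a geometric series once `e ≥ 1`. -/
theorem IsBand.summable_traceTerm {q : ℝ} (hq0 : 0 < q) (hq1 : q < 1)
    (hq : ∀ n, qPoch q q n ≠ 0) {X : Module.End ℝ Fock} {d e : ℕ} (hX : IsBand q X d e)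
    (he : 1 ≤ e) : Summable (traceTerm q X) := by
  obtain ⟨C, hC0, hC⟩ := hX.abs_matElem_le hq0 0
  refine Summable.of_norm_bounded ((summable_geometric_of_lt_one hq0.le hq1).mul_left C)
    fun n => ?_
  rw [traceTerm_eq hq, Real.norm_eq_abs]
  refine (hC n n le_rfl).trans (mul_le_mul_of_nonneg_left ?_ hC0)
  exact pow_le_pow_of_le_one hq0.le hq1.le (Nat.le_mul_of_pos_left n he)

/-- Cyclicity of the Fock space trace. -/
theorem fockTrace_mul_comm {q : ℝ} (hq0 : 0 < q) (hq1 : q < 1) (hq : ∀ n, qPoch q q n ≠ 0)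
    {X Y : Module.End ℝ Fock} {d e d' e' : ℕ} (hX : IsBand q X d e) (hY : IsBand q Y d' e')
    (he : 1 ≤ e + e') : fockTrace q (X * Y) = fockTrace q (Y * X) := by
  obtain ⟨C, hC0, hC⟩ := hX.abs_matElem_le hq0 d'
  obtain ⟨C', hC0', hC'⟩ := hY.abs_matElem_le hq0 d
  -- Decay may be available in only one of `n`, `j`. Since nonzero terms have `|n - j|` bounded,
  -- half of that decay can be transferred to the other index, so `√q` gives a product of two
  -- geometric series.
  set r := Real.sqrt q with hr
  have hr0 : 0 < r := Real.sqrt_pos.mpr hq0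
  have hr1 : r < 1 := by
    rw [hr, Real.sqrt_lt' one_pos]
    simpa using hq1
  have hrq : q = r ^ 2 := (Real.sq_sqrt hq0.le).symm
  have hgeo := summable_geometric_of_lt_one hr0.le hr1
  have hsum : Summable (Function.uncurry fun n j => matElem X n j * matElem Y j n) := by
    refine Summable.of_norm_bounded ((hgeo.mul_of_nonneg hgeo (fun n => (pow_pos hr0 n).le)
      (fun n => (pow_pos hr0 n).le)).mul_left (C * C' * (r ^ (d + d'))⁻¹)) ?_
    rintro ⟨n, j⟩
    simp only [Function.uncurry_apply_pair, Real.norm_eq_abs]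
    have hpos : 0 < r ^ (d + d') := pow_pos hr0 _
    by_cases h1 : j ≤ n + d
    · by_cases h2 : n ≤ j + d'
      · rw [abs_mul]
        refine (mul_le_mul (hC n j h2) (hC' j n h1) (abs_nonneg _) (by positivity)).trans ?_
        have h3 : q ^ (e * n) * q ^ (e' * j) ≤ (r ^ (d + d'))⁻¹ * (r ^ n * r ^ j) := by
          rw [le_inv_mul_iff₀ hpos, hrq, ← pow_mul, ← pow_mul, ← pow_add, ← pow_add, ← pow_add]
          refine pow_le_pow_of_le_one hr0.le hr1.le ?_
          rcases Nat.eq_zero_or_pos e with rfl | h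
          · have := Nat.le_mul_of_pos_left j (show 0 < e' by omega)
            omega
          · have := Nat.le_mul_of_pos_left n h
            omega
        calc C * q ^ (e * n) * (C' * q ^ (e' * j)) = C * C' * (q ^ (e * n) * q ^ (e' * j)) := by ring
          _ ≤ C * C' * ((r ^ (d + d'))⁻¹ * (r ^ n * r ^ j)) := by gcongr
          _ = _ := by ring
      · rw [hY.matElem_eq_zero (by omega), mul_zero, abs_zero]
        positivity
    · rw [hX.matElem_eq_zero (by omega), zero_mul, abs_zero]
      positivity
  have e1 : ∀ n, traceTerm q (X * Y) n = ∑' j, matElem X n j * matElem Y j n := fun n => by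
    rw [traceTerm_eq hq]
    exact ((hX.hasSum_matElem (Y (ket n)) n).tsum_eq).symm
  have e2 : ∀ j, traceTerm q (Y * X) j = ∑' n, matElem X n j * matElem Y j n := fun j => by
    rw [traceTerm_eq hq]
    simp only [mul_comm (matElem X _ _)]
    exact ((hY.hasSum_matElem (X (ket j)) j).tsum_eq).symm
  simp only [fockTrace, e1, e2]
  exact hsum.tsum_comm.symm

end ZRP
end

/-! ### Exchange and rotation under the trace. -/

noncomputable section
namespace ZRP
open Finset

theorem bMinus_pow_mul_kOp_pow (q : ℝ) (i j : ℕ) :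
    bMinus q ^ i * kOp q ^ j = q ^ (i * j) • (kOp q ^ j * bMinus q ^ i) := by
  have h1 : ∀ j, bMinus q * kOp q ^ j = q ^ j • (kOp q ^ j * bMinus q) := by
    intro j
    induction j with
    | zero => simp
    | succ j ih =>
      rw [pow_succ, ← mul_assoc, ih, smul_mul_assoc, mul_assoc, bMinus_mul_kOp, mul_smul_comm,
        smul_smul, mul_assoc, pow_succ]
  induction i with
  | zero => simp
  | succ i ih =>
    rw [pow_succ, mul_assoc, h1, mul_smul_comm, ← mul_assoc, ih, smul_mul_assoc, smul_smul,
      mul_assoc, ← pow_add, add_comm j, ← Nat.succ_mul]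

theorem eOp_mul_eOp (q : ℝ) (δ γ : Local 2) :
    eOp q δ * eOp q γ = q ^ (δ 0 * γ 1) • eOp q (γ + δ) := by
  rw [eOp, eOp, eOp, mul_assoc, ← mul_assoc (bMinus q ^ _), bMinus_pow_mul_kOp_pow, smul_mul_assoc,
    mul_smul_comm, mul_assoc (kOp q ^ γ 1), ← mul_assoc, ← pow_add, ← pow_add, Pi.add_apply,
    Pi.add_apply, add_comm (γ 1), add_comm (γ 0)]

theorem phi_two (α β : Local 2) : phi α β = α 0 * β 1 := by
  have h0 : Ioi (0 : Fin 2) = {1} := rfl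
  have h1 : Ioi (1 : Fin 2) = ∅ := rfl
  simp [phi, h0, h1]

/-- The factors `(mu)_{|β|}` and `(q)_{β_i}` cancel, splitting the weight into a part in `γ` and a
part in `δ`. The leftover power of `q` is the one produced by `eOp_mul_eOp`. -/
theorem gWeight_mul_Phi {q lam mu : ℝ} (hq : ∀ n, qPoch q q n ≠ 0) (hlam : lam ≠ 0) (hmu : mu ≠ 0)
    (hm : ∀ n, qPoch q mu n ≠ 0) (γ δ : Local 2) :
    gWeight q mu (γ + δ) * Phi q γ (γ + δ) lam mu =
      q ^ (δ 0 * γ 1) * (gWeight q lam γ * hWeight q lam mu δ) := by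
  have hs : size (γ + δ) = size γ + size δ := by
    simp only [size_two, Pi.add_apply]
    ring
  have e : γ + δ - γ = δ := by
    ext i
    simp
  rw [Phi, e, phi_two, gWeight, gWeight, hWeight, hs, Nat.add_sub_cancel_left]
  simp only [Fin.prod_univ_two, qBinom, Pi.add_apply, Nat.le_add_right, if_true,
    Nat.add_sub_cancel_left]
  have := hq (γ 0 + δ 0)
  have := hq (γ 1 + δ 1)
  have := hq (γ 0)
  have := hq (δ 0)
  have := hq (γ 1)
  have := hq (δ 1)
  have := hm (size γ + size δ)
  rw [div_pow, pow_add mu⁻¹, inv_pow, inv_pow, inv_pow]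
  field_simp

theorem isBand_dilogOp (q mu : ℝ) : IsBand q (dilogOp q mu) 0 0 := by
  rw [dilogOp_eq_mulOp]
  exact isBand_mulOp q _

theorem isBand_eOp {q : ℝ} (hq0 : 0 < q) (hq1 : q < 1) (α : Local 2) :
    IsBand q (eOp q α) (α 0) (α 1) := by
  simpa [eOp] using ((isBand_kOp hq0).pow hq0 hq1 (α 1)).mul hq0 hq1
    ((isBand_bMinus hq0 hq1).pow hq0 hq1 (α 0))

theorem isBand_zOp {q : ℝ} (hq0 : 0 < q) (hq1 : q < 1) (mu : ℝ) (α : Local 2) :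
    IsBand q (zOp q mu α) (α 0) (α 1) := by
  rw [zOp_eq]
  simpa using (isBand_dilogOp q mu).mul hq0 hq1 (isBand_eOp hq0 hq1 α)

theorem isBand_zProd {q : ℝ} (hq0 : 0 < q) (hq1 : q < 1) {L : ℕ} (mu : Fin L → ℝ)
    (σ : Config L 2) : IsBand q (zProd q mu σ) (∑ i, σ i 0) (∑ i, σ i 1) :=
  isBand_list_prod hq0 hq1 _ _ _ fun i => isBand_zOp hq0 hq1 (mu i) (σ i)

theorem list_prod_ofFn_smul {L : ℕ} (c : Fin L → ℝ) (X : Fin L → Module.End ℝ Fock) :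
    (List.ofFn fun i => c i • X i).prod = (∏ i, c i) • (List.ofFn X).prod := by
  simpa [MultilinearMap.mkPiAlgebraFin_apply] using
    (MultilinearMap.mkPiAlgebraFin ℝ L (Module.End ℝ Fock)).map_smul_univ c X

theorem list_prod_ofFn_sum {A ι : Type*} [Ring A] [Algebra ℝ A] [DecidableEq ι] {L : ℕ}
    (s : Fin L → Finset ι) (X : Fin L → ι → A) :
    (List.ofFn fun i => ∑ j ∈ s i, X i j).prod =
      ∑ r ∈ Fintype.piFinset s, (List.ofFn fun i => X i (r i)).prod := by
  simpa [MultilinearMap.mkPiAlgebraFin_apply] using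
    (MultilinearMap.mkPiAlgebraFin ℝ L A).map_sum_finset X s

theorem list_prod_ofFn_intertwine {A : Type*} [Ring A] {L : ℕ} {D : A} {X Y : Fin L → A}
    (h : ∀ i, D * X i = Y i * D) : D * (List.ofFn X).prod = (List.ofFn Y).prod * D := by
  induction L with
  | zero => simp
  | succ L ih =>
    rw [List.ofFn_succ, List.ofFn_succ, List.prod_cons, List.prod_cons, ← mul_assoc, h, mul_assoc,
      ih fun i => h i.succ, mul_assoc]

theorem list_prod_ofFn_shift {A : Type*} [Ring A] (L : ℕ) (x y : ℕ → A) :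
    (List.ofFn fun i : Fin L => y i * x i).prod * y L =
      y 0 * (List.ofFn fun i : Fin L => x i * y (i + 1)).prod := by
  induction L generalizing x y with
  | zero => simp
  | succ L ih =>
    have := ih (fun i => x (i + 1)) (fun i => y (i + 1))
    simp only [List.ofFn_succ, List.prod_cons, Fin.val_zero, Fin.val_succ, mul_assoc] at this ⊢
    rw [this]

/-- Rotation of the first factor of a cyclic product. -/
theorem list_prod_ofFn_rotate {A : Type*} [Ring A] {L : ℕ} [NeZero L] (x y : Fin L → A) :
    (List.ofFn fun i => y i * x i).prod =
        y 0 * (List.ofFn fun i => if i = 0 then x i else y i * x i).prod ∧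
      (List.ofFn fun i => x i * y (i + 1)).prod =
        (List.ofFn fun i => if i = 0 then x i else y i * x i).prod * y 0 := by
  obtain ⟨n, rfl⟩ := Nat.exists_eq_succ_of_ne_zero (NeZero.ne L)
  constructor
  · simp [List.ofFn_succ, mul_assoc]
  · have h := list_prod_ofFn_shift n (fun i => x (Fin.ofNat (n + 1) (i + 1)))
      (fun i => y (Fin.ofNat (n + 1) (i + 1)))
    have e1 : ∀ i : Fin n, Fin.ofNat (n + 1) ((i : ℕ) + 1) = i.succ := fun i => by
      ext
      simp
    have e2 : ∀ i : Fin n, Fin.ofNat (n + 1) ((i : ℕ) + 1 + 1) = i.succ + 1 := fun i => by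
      ext
      simp [Fin.val_add]
    have e3 : Fin.ofNat (n + 1) (n + 1) = 0 := by
      ext
      simp
    have e4 : Fin.ofNat (n + 1) (0 + 1) = 0 + 1 := by
      ext
      simp
    simp only [e1, e2, e3, e4] at h
    simp only [Nat.succ_eq_add_one, List.ofFn_succ, List.prod_cons, if_true, Fin.succ_ne_zero,
      if_false, mul_assoc, h]

theorem traceTerm_smul (q c : ℝ) (X : Module.End ℝ Fock) :
    traceTerm q (c • X) = fun n => c * traceTerm q X n := by
  ext n
  simp [traceTerm, mul_div_assoc]

theorem fockTrace_smul (q c : ℝ) (X : Module.End ℝ Fock) :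
    fockTrace q (c • X) = c * fockTrace q X := by
  rw [fockTrace, traceTerm_smul, tsum_mul_left, fockTrace]

theorem fockTrace_sum {ι : Type*} (q : ℝ) (s : Finset ι) (X : ι → Module.End ℝ Fock)
    (h : ∀ i ∈ s, Summable (traceTerm q (X i))) :
    fockTrace q (∑ i ∈ s, X i) = ∑ i ∈ s, fockTrace q (X i) := by
  have : traceTerm q (∑ i ∈ s, X i) = fun n => ∑ i ∈ s, traceTerm q (X i) n := by
    ext n
    simp [traceTerm, LinearMap.sum_apply, sum_div]
  rw [fockTrace, this, Summable.tsum_finsetSum h]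
  rfl

theorem isBand_aux {q : ℝ} (hq0 : 0 < q) (hq1 : q < 1) (mu : ℝ) {α γ : Local 2} (h : γ ≤ α) :
    IsBand q (eOp q γ * dilogOp q mu * eOp q (α - γ)) (α 0) (α 1) := by
  have := ((isBand_eOp hq0 hq1 γ).mul hq0 hq1 (isBand_dilogOp q mu)).mul hq0 hq1
    (isBand_eOp hq0 hq1 (α - γ))
  simpa [Nat.add_sub_cancel' (h 0), Nat.add_sub_cancel' (h 1)] using this

/-- The trace identity obtained by conjugation with `(b₊)_∞ / (lam⁻¹ b₊)_∞`. -/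
theorem sum_weight_mul_fockTrace {q : ℝ} (hq0 : 0 < q) (hq1 : q < 1) (hq : ∀ n, qPoch q q n ≠ 0)
    {L : ℕ} {lam : ℝ} (hlam : lam ≠ 0) {mu : Fin L → ℝ} (hmu : ∀ i, mu i ≠ 0) (α : Config L 2)
    (hα : 1 ≤ ∑ i, α i 1) :
    ∑ ε ∈ Fintype.piFinset fun i => Iic (α i),
        (∏ i, gWeight q lam (ε i) * hWeight q lam (mu i) (α i - ε i)) *
          fockTrace q (List.ofFn fun i =>
            eOp q (ε i) * dilogOp q (mu i) * eOp q (α i - ε i)).prod =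
      matrixProduct q mu α := by
  set D := dilogOp q lam with hD
  set D' := mulOp (dilogSeries q lam)⁻¹ with hD'
  have hc : PowerSeries.constantCoeff (dilogSeries q lam) ≠ 0 := by
    rw [← PowerSeries.coeff_zero_eq_constantCoeff_apply]
    simp [dilogSeries, qPoch]
  have hDD' : D * D' = 1 := by
    rw [hD, hD', dilogOp_eq_mulOp, ← mulOp_mul, PowerSeries.mul_inv_cancel _ hc, mulOp_one]
  have hD'D : D' * D = 1 := by
    rw [hD, hD', dilogOp_eq_mulOp, ← mulOp_mul, PowerSeries.inv_mul_cancel _ hc, mulOp_one]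
  have hex := list_prod_ofFn_intertwine (D := D)
    (X := fun i => ∑ γ ∈ Iic (α i), (gWeight q lam γ * hWeight q lam (mu i) (α i - γ)) •
        (eOp q γ * dilogOp q (mu i) * eOp q (α i - γ)))
    (Y := fun i => gWeight q (mu i) (α i) • zOp q (mu i) (α i))
    (fun i => by rw [smul_mul_assoc]; exact dilogOp_exchange hq hlam (hmu i) (α i))
  rw [list_prod_ofFn_sum, list_prod_ofFn_smul (fun i => gWeight q (mu i) (α i))] at hex
  have hsum : ∀ ε ∈ Fintype.piFinset fun i => Iic (α i),
      (∏ i, gWeight q lam (ε i) * hWeight q lam (mu i) (α i - ε i)) *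
          fockTrace q (List.ofFn fun i =>
            eOp q (ε i) * dilogOp q (mu i) * eOp q (α i - ε i)).prod =
      fockTrace q (List.ofFn fun i =>
        (gWeight q lam (ε i) * hWeight q lam (mu i) (α i - ε i)) •
          (eOp q (ε i) * dilogOp q (mu i) * eOp q (α i - ε i))).prod := by
    intro ε _
    rw [list_prod_ofFn_smul, fockTrace_smul]
  rw [sum_congr rfl hsum, ← fockTrace_sum]
  · rw [← one_mul (∑ ε ∈ _, _), ← hD'D, mul_assoc, hex]
    -- `Tr (D' Y D) = Tr (Y D D') = Tr Y`. Neither `D` nor `D'` decays, so cyclicity uses the decay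
    -- of `Y`.
    change fockTrace q (D' * ((∏ i, gWeight q (mu i) (α i)) • zProd q mu α * D)) = _
    rw [
      fockTrace_mul_comm hq0 hq1 hq (isBand_mulOp q _)
        ((((isBand_zProd hq0 hq1 mu α)).smul _).mul hq0 hq1 (isBand_dilogOp q lam)) (by omega),
      mul_assoc, hDD', mul_one, fockTrace_smul]
    rfl
  · intro ε hε
    rw [list_prod_ofFn_smul]
    refine ((isBand_list_prod hq0 hq1 _ _ _ fun i =>
      isBand_aux hq0 hq1 (mu i) ?_).smul _).summable_traceTerm hq0 hq1 hq hα
    exact mem_Iic.mp (Fintype.mem_piFinset.mp hε i)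

/-- Each `e_{ε_{i+1}}` joins the preceding site after a cyclic rotation, rebuilding a `Z` operator
there. The weights `g_{ε_{i+1}}(lam)` are reindexed around the ring in the same way. -/
theorem matrixProduct_mul_prod_Phi {q : ℝ} (hq0 : 0 < q) (hq1 : q < 1)
    (hq : ∀ n, qPoch q q n ≠ 0) {L : ℕ} [NeZero L] {lam : ℝ} (hlam : lam ≠ 0) {mu : Fin L → ℝ}
    (hmu : ∀ i, mu i ≠ 0) (hmq : ∀ i n, qPoch q (mu i) n ≠ 0) (α ε : Config L 2)
    (hα : 1 ≤ ∑ i, α i 1) (hε : ε ≤ α) :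
    (∏ i, Phi q (ε (i + 1)) (ε (i + 1) + (α i - ε i)) lam (mu i)) *
        matrixProduct q mu (fun i => ε (i + 1) + (α i - ε i)) =
      (∏ i, gWeight q lam (ε i) * hWeight q lam (mu i) (α i - ε i)) *
          fockTrace q (List.ofFn fun i =>
            eOp q (ε i) * dilogOp q (mu i) * eOp q (α i - ε i)).prod := by
  have h1 : ∏ i, gWeight q lam (ε (i + 1)) = ∏ i, gWeight q lam (ε i) :=
    Equiv.prod_comp (Equiv.addRight (1 : Fin L)) fun i => gWeight q lam (ε i)
  have h2 : ∀ i, q ^ ((α i - ε i) 0 * ε (i + 1) 1) • zOp q (mu i) (ε (i + 1) + (α i - ε i)) =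
      (dilogOp q (mu i) * eOp q (α i - ε i)) * eOp q (ε (i + 1)) := by
    intro i
    rw [mul_assoc, eOp_mul_eOp, mul_smul_comm, zOp_eq]
  have h3 : fockTrace q (List.ofFn fun i =>
        eOp q (ε i) * dilogOp q (mu i) * eOp q (α i - ε i)).prod =
      fockTrace q (List.ofFn fun i =>
        (dilogOp q (mu i) * eOp q (α i - ε i)) * eOp q (ε (i + 1))).prod := by
    obtain ⟨r1, r2⟩ := list_prod_ofFn_rotate (fun i => dilogOp q (mu i) * eOp q (α i - ε i))
      (fun i => eOp q (ε i))
    simp only [mul_assoc (eOp q _) (dilogOp q _)]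
    rw [r1, r2]
    refine fockTrace_mul_comm hq0 hq1 hq (isBand_eOp hq0 hq1 (ε 0)) (isBand_list_prod hq0 hq1 _
      -- Only site `0` has lost its left factor `e_{ε_0}`; the two band exponents in `k` together
      -- still add up to at least `∑ i, α i 1`.
      (fun i => α i 0 - if i = 0 then ε i 0 else 0)
      (fun i => α i 1 - if i = 0 then ε i 1 else 0) fun i => ?_) ?_
    · split_ifs
      · simpa using (isBand_dilogOp q (mu i)).mul hq0 hq1 (isBand_eOp hq0 hq1 (α i - ε i))
      · simpa [mul_assoc] using isBand_aux hq0 hq1 (mu i) (hε i)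
    · have hs : ε 0 1 = ∑ i, if i = 0 then ε i 1 else 0 := by simp
      rw [hs, ← sum_add_distrib]
      exact hα.trans (sum_le_sum fun i _ => le_add_tsub)
  rw [matrixProduct, ← mul_assoc, ← prod_mul_distrib, h3]
  simp only [← h2]
  rw [list_prod_ofFn_smul, fockTrace_smul]
  simp only [mul_comm (Phi _ _ _ _ _),
    gWeight_mul_Phi hq hlam (hmu _) (hmq _), prod_mul_distrib, h1]
  rw [zProd]
  ring

end ZRP
end

/-! ### Stationarity. -/

noncomputable section
namespace ZRP
open Finset

/-- Indexing by the incoming edge `ε_i = γ_{i-1}` bounds the sum by the final configuration: `γ_i ≤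
β_i` and `γ_i + α_i = ε_i + β_i` force `ε_i ≤ α_i`. -/
theorem transferEntry_eq_sum (q : ℝ) {L : ℕ} [NeZero L] (lam : ℝ) (mu : Fin L → ℝ)
    (α β : Config L 2) :
    transferEntry q lam mu α β = ∑ ε ∈ Fintype.piFinset fun i => Iic (α i),
      ∏ i, stochR q lam (mu i) (ε i) (β i) (ε (i + 1)) (α i) := by
  have h := finsum_comp_equiv ((Equiv.addRight (1 : Fin L)).symm.arrowCongr (Equiv.refl (Local 2)))
    (f := fun γ : Config L 2 => ∏ i, stochR q lam (mu i) (γ (i - 1)) (β i) (γ i) (α i))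
  rw [transferEntry, ← h]
  have e : ∀ (ε : Config L 2) (i : Fin L),
      ((Equiv.addRight (1 : Fin L)).symm.arrowCongr (Equiv.refl (Local 2))) ε i = ε (i + 1) :=
    fun ε i => rfl
  simp only [e, sub_add_cancel]
  refine finsum_eq_sum_of_support_subset _ fun ε hε => ?_
  have hne := transferEntry_term_ne_zero q lam mu α β (fun i => ε (i + 1))
    (by simpa only [sub_add_cancel] using! hε)
  rw [mem_coe, Fintype.mem_piFinset]
  intro i
  rw [mem_Iic]
  have h1 := (hne i).1
  have h2 := (hne i).2
  simp only [sub_add_cancel] at h2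
  intro a
  have h3 : ε (i + 1) a ≤ β i a := h1 a
  have h4 : ε (i + 1) a + α i a = ε i a + β i a := congrFun h2 a
  change ε i a ≤ α i a
  omega

theorem transferEntry_eq_zero (q : ℝ) {L n : ℕ} [NeZero L] (lam : ℝ) (mu : Fin L → ℝ)
    {α β : Config L n} (h : ∑ i, α i ≠ ∑ i, β i) : transferEntry q lam mu α β = 0 := by
  refine finsum_eq_zero_of_forall_eq_zero fun γ => ?_
  by_contra hne
  have h1 := transferEntry_term_ne_zero q lam mu α β γ hne
  have h2 : ∑ i, (γ i + α i) = ∑ i, (γ (i - 1) + β i) := sum_congr rfl fun i _ => (h1 i).2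
  have h3 : ∑ i, γ (i - 1) = ∑ i, γ i := Equiv.sum_comp (Equiv.subRight (1 : Fin L)) γ
  rw [sum_add_distrib, sum_add_distrib, h3] at h2
  exact h (add_left_cancel h2)

/-- The matrix product expression is stationary. -/
theorem sum_matrixProduct_mul_transferEntry {q : ℝ} (hq0 : 0 < q) (hq1 : q < 1)
    (hq : ∀ n, qPoch q q n ≠ 0) {L : ℕ} [NeZero L] {lam : ℝ} (hlam : lam ≠ 0) {mu : Fin L → ℝ}
    (hmu : ∀ i, mu i ≠ 0) (hmq : ∀ i n, qPoch q (mu i) n ≠ 0) {m : Local 2} (hm : 1 ≤ m 1)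
    {α : Config L 2} (hα : α ∈ sector L m) :
    ∑ σ ∈ (sector_finite L m).toFinset, matrixProduct q mu σ * transferEntry q lam mu α σ =
      matrixProduct q mu α := by
  have hα' : ∑ i, α i = m := hα
  have hα1 : 1 ≤ ∑ i, α i 1 := by
    rw [← hα', Finset.sum_apply] at hm
    exact hm
  rw [← sum_weight_mul_fockTrace hq0 hq1 hq hlam hmu α hα1]
  simp only [transferEntry_eq_sum, mul_sum]
  rw [sum_comm]
  refine sum_congr rfl fun ε hε => ?_
  have hle : ε ≤ α := fun i => mem_Iic.mp (Fintype.mem_piFinset.mp hε i)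
  -- Given the edges `ε` and the outcome `α`, local conservation leaves one possible source
  -- configuration.
  rw [← matrixProduct_mul_prod_Phi hq0 hq1 hq hlam hmu hmq α ε hα1 hle, sum_eq_single
    (fun i => ε (i + 1) + (α i - ε i)), mul_comm]
  · congr 1
    refine prod_congr rfl fun i _ => ?_
    rw [stochR, if_pos]
    rw [add_left_comm, add_tsub_cancel_of_le (hle i)]
  · intro σ _ hne
    obtain ⟨i, hi⟩ := Function.ne_iff.mp hne
    rw [prod_eq_zero (mem_univ i), mul_zero]
    rw [stochR, if_neg]
    intro h
    apply hi
    ext a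
    have h1 : ε (i + 1) a + α i a = ε i a + σ i a := congrFun h a
    have h2 : ε i a ≤ α i a := hle i a
    change σ i a = ε (i + 1) a + (α i a - ε i a)
    omega
  · intro hn
    exfalso
    apply hn
    rw [Set.Finite.mem_toFinset]
    change ∑ i, (ε (i + 1) + (α i - ε i)) = m
    have h3 : ∑ i, ε (i + 1) = ∑ i, ε i := Equiv.sum_comp (Equiv.addRight (1 : Fin L)) ε
    rw [sum_add_distrib, h3, ← sum_add_distrib, ← hα']
    exact sum_congr rfl fun i _ => add_tsub_cancel_of_le (hle i)

/-! ### Positivity of the weights and traces. -/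

section Positivity

theorem gWeight_pos {q mu : ℝ} (hq0 : 0 < q) (hq1 : q < 1) (hm0 : 0 < mu) (hm1 : mu < 1) {n : ℕ}
    (α : Local n) : 0 < gWeight q mu α :=
  div_pos (mul_pos (pow_pos (inv_pos.mpr hm0) _) (qPoch_pos hq0 hq1 hm0.le hm1 _))
    (prod_pos fun _ _ => qPoch_pos hq0 hq1 hq0.le hq1 _)

theorem Phi_pos {q lam mu : ℝ} (hq0 : 0 < q) (hq1 : q < 1) (hm0 : 0 < mu) (hml : mu < lam)
    (hl : lam < 1) {n : ℕ} {γ β : Local n} (h : γ ≤ β) : 0 < Phi q γ β lam mu := by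
  have hl0 := hm0.trans hml
  refine mul_pos (mul_pos (mul_pos (pow_pos hq0 _) (pow_pos (div_pos hm0 hl0) _)) ?_)
    (prod_pos fun i _ => ?_)
  · exact div_pos (mul_pos (qPoch_pos hq0 hq1 hl0.le hl _)
      (qPoch_pos hq0 hq1 (div_pos hm0 hl0).le ((div_lt_one hl0).mpr hml) _))
      (qPoch_pos hq0 hq1 hm0.le (hml.trans hl) _)
  · rw [qBinom, if_pos (h i)]
    exact div_pos (qPoch_pos hq0 hq1 hq0.le hq1 _)
      (mul_pos (qPoch_pos hq0 hq1 hq0.le hq1 _) (qPoch_pos hq0 hq1 hq0.le hq1 _))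

theorem stochR_nonneg {q lam mu : ℝ} (hq0 : 0 < q) (hq1 : q < 1) (hm0 : 0 < mu) (hml : mu < lam)
    (hl : lam < 1) {n : ℕ} (α β γ δ : Local n) : 0 ≤ stochR q lam mu α β γ δ := by
  rw [stochR]
  split_ifs
  · by_cases h : γ ≤ β
    · exact (Phi_pos hq0 hq1 hm0 hml hl h).le
    · rw [Phi_eq_zero q _ _ _ _ h]
  · exact le_rfl

theorem bMinus_pow_nonneg {q : ℝ} (hq0 : 0 < q) (hq1 : q < 1) (j : ℕ) {v : Fock}
    (hv : ∀ n, 0 ≤ v n) : (∀ n, 0 ≤ (bMinus q ^ j) v n) ∧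
      ∀ n, 0 < v (n + j) → 0 < (bMinus q ^ j) v n := by
  have h1 : ∀ n, 0 < 1 - q ^ (n + 1) := fun n =>
    sub_pos.mpr (pow_lt_one₀ hq0.le hq1 (Nat.succ_ne_zero n))
  induction j with
  | zero => exact ⟨by simpa using hv, by simp⟩
  | succ j ih =>
    rw [pow_succ']
    refine ⟨fun n => mul_nonneg (h1 n).le (ih.1 _), fun n hn => mul_pos (h1 n) (ih.2 _ ?_)⟩
    rwa [add_assoc, add_comm 1 j]

theorem kOp_pow_apply (q : ℝ) (j : ℕ) (v : Fock) (n : ℕ) :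
    (kOp q ^ j) v n = q ^ (n * j) * v n := by
  induction j with
  | zero => simp
  | succ j ih =>
    rw [pow_succ', Module.End.mul_apply]
    change q ^ n * (kOp q ^ j) v n = _
    rw [ih, ← mul_assoc, ← pow_add, Nat.mul_succ, add_comm]

/-- `b₋` lowers the positive entry from `N + α 0` to `N`; the series in `b₊` has positive
coefficients and spreads it to every `n ≥ N`. -/
theorem zOp_pos {q mu : ℝ} (hq0 : 0 < q) (hq1 : q < 1) (hm0 : 0 < mu) (hm1 : mu < 1) (α : Local 2)
    {v : Fock} (hv : ∀ n, 0 ≤ v n) : (∀ n, 0 ≤ zOp q mu α v n) ∧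
      ∀ N, 0 < v (N + α 0) → ∀ n, N ≤ n → 0 < zOp q mu α v n := by
  obtain ⟨h1, h2⟩ := bMinus_pow_nonneg hq0 hq1 (α 0) hv
  have hc : ∀ j, 0 < PowerSeries.coeff j (dilogSeries q mu) := fun j => by
    rw [dilogSeries, PowerSeries.coeff_mk]
    exact mul_pos (div_pos (qPoch_pos hq0 hq1 hm0.le hm1 _) (qPoch_pos hq0 hq1 hq0.le hq1 _))
      (pow_pos (inv_pos.mpr hm0) _)
  have hz : ∀ n, zOp q mu α v n = ∑ p ∈ antidiagonal n, PowerSeries.coeff p.1 (dilogSeries q mu) *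
      (q ^ (p.2 * α 1) * (bMinus q ^ α 0) v p.2) := by
    intro n
    simp only [zOp, dilogOp_eq_mulOp, Module.End.mul_apply, mulOp_apply, kOp_pow_apply]
  have hn : ∀ n : ℕ, ∀ p ∈ HasAntidiagonal.antidiagonal n, 0 ≤ PowerSeries.coeff p.1 (dilogSeries q mu) *
      (q ^ (p.2 * α 1) * (bMinus q ^ α 0) v p.2) := fun n p _ =>
    mul_nonneg (hc _).le (mul_nonneg (pow_pos hq0 _).le (h1 _))
  refine ⟨fun n => ?_, fun N hN n hNn => ?_⟩
  · rw [hz]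
    exact sum_nonneg (hn n)
  · rw [hz]
    refine sum_pos' (hn n) ⟨(n - N, N), ?_, ?_⟩
    · simp [hNn]
    · exact mul_pos (hc _) (mul_pos (pow_pos hq0 _) (h2 _ hN))

theorem zProd_pos {q : ℝ} (hq0 : 0 < q) (hq1 : q < 1) {L : ℕ} {mu : Fin L → ℝ}
    (hm0 : ∀ i, 0 < mu i) (hm1 : ∀ i, mu i < 1) (σ : Config L 2) {v : Fock} (hv : ∀ n, 0 ≤ v n) :
    (∀ n, 0 ≤ zProd q mu σ v n) ∧
      ∀ N, 0 < v (N + ∑ i, σ i 0) → 0 < zProd q mu σ v N ∧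
        (L ≠ 0 → ∀ n, N ≤ n → 0 < zProd q mu σ v n) := by
  induction L with
  | zero => simpa [zProd] using hv
  | succ L ih =>
    obtain ⟨h1, h2⟩ := ih (fun i => hm0 i.succ) (fun i => hm1 i.succ) (fun i => σ i.succ)
    have hp : zProd q mu σ =
        zOp q (mu 0) (σ 0) * zProd q (fun i => mu i.succ) (fun i => σ i.succ) := by
      rw [zProd, List.ofFn_succ, List.prod_cons, zProd]
    obtain ⟨h3, h4⟩ := zOp_pos hq0 hq1 (hm0 0) (hm1 0) (σ 0) h1
    rw [hp]
    refine ⟨h3, fun N hN => ?_⟩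
    rw [Fin.sum_univ_succ, ← add_assoc] at hN
    have h5 := h4 N (h2 _ hN).1
    exact ⟨h5 N le_rfl, fun _ => h5⟩

theorem matrixProduct_pos {q : ℝ} (hq0 : 0 < q) (hq1 : q < 1) {L : ℕ} [NeZero L] {mu : Fin L → ℝ}
    (hm0 : ∀ i, 0 < mu i) (hm1 : ∀ i, mu i < 1) (σ : Config L 2)
    (hs : Summable (traceTerm q (zProd q mu σ))) : 0 < matrixProduct q mu σ := by
  have hq : ∀ n, qPoch q q n ≠ 0 := fun n => (qPoch_pos hq0 hq1 hq0.le hq1 n).ne'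
  have hk : ∀ j n, 0 ≤ ket j n := fun j n => by
    simp only [ket, Pi.single_apply]
    split_ifs <;> norm_num
  refine mul_pos (prod_pos fun i _ => gWeight_pos hq0 hq1 (hm0 i) (hm1 i) _) ?_
  -- From this level the annihilations of all sites can reach level `0` without vanishing, and the
  -- leftmost series in `b₊` returns to the diagonal.
  refine hs.tsum_pos (fun n => ?_) (∑ i, σ i 0) ?_
  · rw [traceTerm_eq hq]
    exact (zProd_pos hq0 hq1 hm0 hm1 σ (hk n)).1 n
  · rw [traceTerm_eq hq]
    exact ((zProd_pos hq0 hq1 hm0 hm1 σ (hk _)).2 0 (by simp [ket])).2 (NeZero.ne L) _ (Nat.zero_le _)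

end Positivity

end ZRP
end

/-! ### Irreducibility and uniqueness. -/

noncomputable section
namespace ZRP
open Finset

/-- The configuration with a single particle of species `a` at the site `i`. -/
def particle {L : ℕ} (i : Fin L) (a : Fin 2) : Config L 2 := Pi.single i (Pi.single a 1)

theorem transferEntry_particle_pos {q lam : ℝ} (hq0 : 0 < q) (hq1 : q < 1) {L : ℕ} [NeZero L]
    {mu : Fin L → ℝ} (hm0 : ∀ i, 0 < mu i) (hml : ∀ i, mu i < lam) (hl : lam < 1)
    (τ : Config L 2) (a : Fin 2) (i : Fin L) :
    0 < transferEntry q lam mu (τ + particle (i + 1) a) (τ + particle i a) := by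
  rw [transferEntry_eq_sum]
  -- The witness carries one particle on the edge from `i` to `i + 1` and nothing on the other
  -- edges.
  refine sum_pos' (fun ε _ => prod_nonneg fun j _ =>
    stochR_nonneg hq0 hq1 (hm0 j) (hml j) hl _ _ _ _) ⟨particle (i + 1) a, ?_, ?_⟩
  · rw [Fintype.mem_piFinset]
    intro j
    rw [mem_Iic]
    exact le_add_self
  · refine prod_pos fun j _ => ?_
    have h : (particle (i + 1) a : Config L 2) (j + 1) = particle i a j := by
      simp [particle, Pi.single_apply]
    rw [stochR, if_pos, h]
    · exact Phi_pos hq0 hq1 (hm0 j) (hml j) hl le_add_self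
    · rw [h, Pi.add_apply, Pi.add_apply, add_left_comm, add_comm (particle i a j), add_left_comm]

/-- The one-sided hypothesis suffices because the sites form a ring: going around leads from any `j`
to any `i`. -/
theorem eq_zero_of_move {L : ℕ} [NeZero L] (Z : Config L 2 → Prop)
    (hZ : ∀ τ a i, Z (τ + particle (i + 1) a) → Z (τ + particle i a)) (τ : Config L 2) (a : Fin 2)
    (i j : Fin L) (h : Z (τ + particle j a)) : Z (τ + particle i a) := by
  have key : ∀ (k : ℕ) (i : Fin L), Z (τ + particle (i + Fin.ofNat L k) a) → Z (τ + particle i a) := by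
    intro k
    induction k with
    | zero =>
      intro i h
      rwa [show Fin.ofNat L 0 = 0 from rfl, add_zero] at h
    | succ k ih =>
      intro i h
      refine hZ τ a i (ih (i + 1) ?_)
      have e : Fin.ofNat L (k + 1) = 1 + Fin.ofNat L k := by
        ext
        simp [Fin.val_add, add_comm]
      rwa [add_assoc, ← e]
  refine key (j - i).val i ?_
  have e : Fin.ofNat L (j - i).val = j - i := by
    ext
    exact Nat.mod_eq_of_lt (j - i).isLt
  rwa [e, add_sub_cancel]

/-- A property of configurations which is stable under moving single particles holds for a
configuration if and only if it holds after collecting all particles at the site `0`. -/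
theorem iff_of_move {L : ℕ} [NeZero L] (Z : Config L 2 → Prop)
    (hZ : ∀ τ a i, Z (τ + particle (i + 1) a) → Z (τ + particle i a)) (σ : Config L 2) :
    Z σ ↔ Z (Pi.single 0 (∑ i, σ i)) := by
  -- Induction on the number of particles away from site `0`.
  induction hk : ∑ i, (if i = 0 then 0 else size (σ i)) using Nat.strong_induction_on generalizing σ
    with
  | _ k ih =>
    by_cases h0 : ∃ i a, i ≠ 0 ∧ σ i a ≠ 0
    · obtain ⟨i, a, hi, ha⟩ := h0
      obtain ⟨τ, rfl⟩ : ∃ τ, σ = τ + particle i a := by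
        refine ⟨σ - particle i a, ?_⟩
        rw [tsub_add_cancel_of_le]
        intro j b
        by_cases hj : j = i
        · subst hj
          by_cases hb : b = a
          · subst hb
            simpa [particle] using Nat.one_le_iff_ne_zero.mpr ha
          · simp [particle, hb]
        · simp [particle, hj]
      have hsum : ∑ j, (τ + particle i a) j = ∑ j, (τ + particle 0 a : Config L 2) j := by
        simp [sum_add_distrib, particle]
      have hadd : ∀ j, size ((τ + particle i a) j) = size (τ j) + size (particle i a j) := fun j => by
        simp [size, sum_add_distrib]
      rw [hsum, ← ih _ ?_ (τ + particle 0 a) rfl]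
      · exact ⟨eq_zero_of_move Z hZ τ a 0 i, eq_zero_of_move Z hZ τ a i 0⟩
      · rw [← hk]
        refine sum_lt_sum (fun j _ => ?_) ⟨i, mem_univ i, ?_⟩
        · by_cases hj : j = 0
          · simp [hj]
          · rw [if_neg hj, if_neg hj, hadd]
            simp [particle, hj, size]
        · simp [hi, particle, size, sum_add_distrib]
    · push Not at h0
      have hσ : σ = Pi.single 0 (∑ i, σ i) := by
        have h1 : ∀ i, i ≠ 0 → σ i = 0 := fun i hi => funext fun a => h0 i a hi
        have h2 : ∑ i, σ i = σ 0 := sum_eq_single 0 (fun i _ hi => h1 i hi) (by simp)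
        rw [h2]
        ext i
        by_cases hi : i = 0
        · simp [hi]
        · simp [hi, h1 i hi]
      rw [← hσ]

/-- Uniqueness of the stationary vector: Perron–Frobenius for the irreducible transfer matrix in a
sector. -/
theorem stationary_unique {q lam : ℝ} (hq0 : 0 < q) (hq1 : q < 1) {L : ℕ} [NeZero L]
    {mu : Fin L → ℝ} (hm0 : ∀ i, 0 < mu i) (hml : ∀ i, mu i < lam) (hl : lam < 1) (m : Local 2)
    {P u : Config L 2 → ℝ} (hP0 : ∀ σ ∈ sector L m, 0 < P σ)
    (hP : ∀ α ∈ sector L m,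
      ∑ σ ∈ (sector_finite L m).toFinset, P σ * transferEntry q lam mu α σ = P α)
    (hu : ∀ α ∈ sector L m,
      ∑ σ ∈ (sector_finite L m).toFinset, u σ * transferEntry q lam mu α σ = u α) :
    ∃ c : ℝ, ∀ σ ∈ sector L m, u σ = c * P σ := by
  set S := (sector_finite L m).toFinset with hS
  have hmem : ∀ σ, σ ∈ S ↔ σ ∈ sector L m := fun σ => Set.Finite.mem_toFinset _
  have hne : S.Nonempty := ⟨Pi.single 0 m, by rw [hmem]; simp [sector]⟩
  -- With `c` the minimal ratio, `u - c P` is a nonnegative fixed vector with a zero. Zeros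
  -- propagate backwards along positive entries, hence through the whole sector.
  obtain ⟨σ₀, hσ₀, hmin⟩ := exists_min_image S (fun σ => u σ / P σ) hne
  set c := u σ₀ / P σ₀ with hc
  have hw0 : ∀ σ ∈ S, 0 ≤ u σ - c * P σ := fun σ hσ => by
    have := hmin σ hσ
    rw [le_div_iff₀ (hP0 σ ((hmem σ).mp hσ))] at this
    linarith
  have hT0 : ∀ α σ : Config L 2, 0 ≤ transferEntry q lam mu α σ := fun α σ => by
    rw [transferEntry_eq_sum]
    exact sum_nonneg fun ε _ => prod_nonneg fun j _ =>
      stochR_nonneg hq0 hq1 (hm0 j) (hml j) hl _ _ _ _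
  have hw : ∀ α ∈ S, ∑ σ ∈ S, (u σ - c * P σ) * transferEntry q lam mu α σ = u α - c * P α := by
    intro α hα
    rw [hmem] at hα
    rw [← hu α hα, ← hP α hα, mul_sum, ← sum_sub_distrib]
    exact sum_congr rfl fun σ _ => by ring
  have hback : ∀ α ∈ S, ∀ σ ∈ S, 0 < transferEntry q lam mu α σ → u α - c * P α = 0 →
      u σ - c * P σ = 0 := by
    intro α hα σ hσ hpos h0
    rw [← hw α hα, sum_eq_zero_iff_of_nonneg fun σ hσ => mul_nonneg (hw0 σ hσ) (hT0 α σ)] at h0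
    exact (mul_eq_zero.mp (h0 σ hσ)).resolve_right hpos.ne'
  have hmove : ∀ (τ : Config L 2) (a : Fin 2) (i : Fin L),
      (τ + particle (i + 1) a ∈ S → u (τ + particle (i + 1) a) - c * P (τ + particle (i + 1) a) = 0) →
      τ + particle i a ∈ S → u (τ + particle i a) - c * P (τ + particle i a) = 0 := by
    intro τ a i h hi
    have hsum : ∑ j, (τ + particle (i + 1) a : Config L 2) j =
        ∑ j, (τ + particle i a : Config L 2) j := by
      simp [sum_add_distrib, particle]
    have hi' : τ + particle (i + 1) a ∈ S := by
      rw [hmem] at hi ⊢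
      exact hsum.trans hi
    exact hback _ hi' _ hi (transferEntry_particle_pos hq0 hq1 hm0 hml hl τ a i) (h hi')
  have hiff := iff_of_move (fun σ => σ ∈ S → u σ - c * P σ = 0) hmove
  have hσ₀z : u σ₀ - c * P σ₀ = 0 := by
    rw [hc, div_mul_cancel₀ _ (hP0 _ ((hmem _).mp hσ₀)).ne', sub_self]
  have hstar := (hiff σ₀).mp fun _ => hσ₀z
  refine ⟨c, fun σ hσ => sub_eq_zero.mp ((hiff σ).mpr ?_ ((hmem σ).mpr hσ))⟩
  have e1 : ∑ i, σ₀ i = m := (hmem _).mp hσ₀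
  have e2 : ∑ i, σ i = m := hσ
  rw [e2]
  rwa [e1] at hstar

theorem transfer_apply (q : ℝ) {L : ℕ} [NeZero L] (lam : ℝ) (mu : Fin L → ℝ) (m : Local 2)
    {v : StateSpace L 2} (hv : v ∈ sectorSpace L m) (α : Config L 2) :
    transfer q lam mu v α =
      ∑ σ ∈ (sector_finite L m).toFinset, v σ * (transferEntry q lam mu α σ : ℂ) := by
  rw [transfer, Finsupp.linearCombination_apply, Finsupp.sum_of_support_subset v
    (s := (sector_finite L m).toFinset) _ _ (by simp)]
  · rw [Finsupp.finsetSum_apply]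
    rfl
  · intro σ hσ
    rw [Set.Finite.mem_toFinset]
    exact hv hσ

theorem matrixProductState_apply (q : ℝ) {L : ℕ} (mu : Fin L → ℝ) (m : Local 2) (α : Config L 2)
    [Decidable (α ∈ sector L m)] :
    matrixProductState q mu m α = if α ∈ sector L m then (matrixProduct q mu α : ℂ) else 0 := by
  classical
  rw [matrixProductState, Finsupp.finsetSum_apply]
  simp only [Finsupp.single_apply]
  rw [sum_ite_eq']
  simp only [Set.Finite.mem_toFinset]

theorem matrixProductState_mem (q : ℝ) {L : ℕ} (mu : Fin L → ℝ) (m : Local 2) :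
    matrixProductState q mu m ∈ sectorSpace L m := by
  refine Submodule.sum_mem _ fun σ hσ => Finsupp.single_mem_supported ℂ _ ?_
  exact (Set.Finite.mem_toFinset _).mp hσ

end ZRP

end

theorem mainTheorem3 (L : ℕ) [NeZero L] (q : ℝ) (hq0 : 0 < q) (hq1 : q < 1)
    (mu : Fin L → ℝ) (hmu0 : ∀ i, 0 < mu i) (hmu1 : ∀ i, mu i < 1)
    (m : ZRP.Local 2) (hm : ∀ a, 1 ≤ m a) :
    (∀ σ ∈ ZRP.sector L m, Summable (ZRP.traceTerm q (ZRP.zProd q mu σ))) ∧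
    (∀ σ ∈ ZRP.sector L m, 0 < ZRP.matrixProduct q mu σ) ∧
    ∀ lam : ℝ, (∀ i, mu i < lam) → lam < 1 →
      ZRP.transfer q lam mu (ZRP.matrixProductState q mu m) = ZRP.matrixProductState q mu m ∧
      ∀ v ∈ ZRP.sectorSpace L m, ZRP.transfer q lam mu v = v →
        ∃ c : ℂ, v = c • ZRP.matrixProductState q mu m := by
  classical
  have hq : ∀ n, ZRP.qPoch q q n ≠ 0 := fun n => (ZRP.qPoch_pos hq0 hq1 hq0.le hq1 n).ne'
  have hsum : ∀ σ ∈ ZRP.sector L m, Summable (ZRP.traceTerm q (ZRP.zProd q mu σ)) := by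
    intro σ hσ
    refine (ZRP.isBand_zProd hq0 hq1 mu σ).summable_traceTerm hq0 hq1 hq ?_
    have h : ∑ i, σ i = m := hσ
    have h1 := hm 1
    rwa [← h, Finset.sum_apply] at h1
  have hpos : ∀ σ ∈ ZRP.sector L m, 0 < ZRP.matrixProduct q mu σ := fun σ hσ =>
    ZRP.matrixProduct_pos hq0 hq1 hmu0 hmu1 σ (hsum σ hσ)
  refine ⟨hsum, hpos, fun lam hlam hlam1 => ?_⟩
  have hlam0 : lam ≠ 0 := ((hmu0 0).trans (hlam 0)).ne'
  have hstat : ∀ α ∈ ZRP.sector L m, ∑ σ ∈ (ZRP.sector_finite L m).toFinset,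
      ZRP.matrixProduct q mu σ * ZRP.transferEntry q lam mu α σ = ZRP.matrixProduct q mu α :=
    fun α hα => ZRP.sum_matrixProduct_mul_transferEntry hq0 hq1 hq hlam0 (fun i => (hmu0 i).ne')
      (fun i n => (ZRP.qPoch_pos hq0 hq1 (hmu0 i).le (hmu1 i) n).ne') (hm 1) hα
  constructor
  · ext α
    rw [ZRP.transfer_apply q lam mu m (ZRP.matrixProductState_mem q mu m),
      ZRP.matrixProductState_apply]
    split_ifs with hα
    · rw [← hstat α hα, Complex.ofReal_sum]
      refine Finset.sum_congr rfl fun σ hσ => ?_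
      rw [ZRP.matrixProductState_apply, if_pos ((Set.Finite.mem_toFinset _).mp hσ),
        Complex.ofReal_mul]
    · refine Finset.sum_eq_zero fun σ hσ => ?_
      have h : ∑ i, σ i = m := (ZRP.sector_finite L m).mem_toFinset.mp hσ
      rw [ZRP.transferEntry_eq_zero, Complex.ofReal_zero, mul_zero]
      rw [h]
      exact hα
  · intro v hv hfix
    have hvα : ∀ α, ∑ σ ∈ (ZRP.sector_finite L m).toFinset,
        v σ * (ZRP.transferEntry q lam mu α σ : ℂ) = v α := fun α => by
      rw [← ZRP.transfer_apply q lam mu m hv, hfix]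
    -- The transfer matrix is real, so real and imaginary parts are fixed separately.
    obtain ⟨c, hc⟩ := ZRP.stationary_unique hq0 hq1 hmu0 hlam hlam1 m (u := fun σ => (v σ).re)
      hpos hstat fun α _ => by simpa [Complex.re_sum] using congrArg Complex.re (hvα α)
    obtain ⟨d, hd⟩ := ZRP.stationary_unique hq0 hq1 hmu0 hlam hlam1 m (u := fun σ => (v σ).im)
      hpos hstat fun α _ => by simpa [Complex.im_sum] using congrArg Complex.im (hvα α)
    refine ⟨⟨c, d⟩, ?_⟩
    ext α
    rw [Finsupp.smul_apply, ZRP.matrixProductState_apply]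
    split_ifs with hα
    · apply Complex.ext
      · simpa using hc α hα
      · simpa using hd α hα
    · rw [smul_zero]
      by_contra hne
      exact hα (hv (Finsupp.mem_support_iff.mpr hne))
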